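/- Let $0<L_1<L_2<L_3$ and let $a,b,m,k,\tau>0$. Put $I=(L_1,L_2)$ and $O=(0,L_1)\cup(L_2,L_3)$; all function spaces are complex valued. Let $$\mathcal H=\Big\{[u^1,v^1,\theta,q,u^2,v^2]\in H^1(I)\times H^1(O)\times L^2(I)\times L^2(I)\times L^2(I)\times L^2(O)\ :\ v^1(0)=v^1(L_3)=0,\ u^1(L_i)=v^1(L_i)\ (i=1,2)\Big\}$$ with the inner product $$\langle U,\tilde U\rangle_{\mathcal H}=\int_{I}\big(a\,u^1_x\overline{\tilde u^1_x}+u^2\overline{\tilde u^2}+\theta\overline{\tilde\theta}+\tau q\overline{\tilde q}\big)\,dx+\int_{O}\big(b\,v^1_x\overline{\tilde v^1_x}+v^2\overline{\tilde v^2}\big)\,dx .$$ Define the linear operator $\mathcal A\colon\mathcal H\supseteq D(\mathcal A)\to\mathcal H$ by $$\mathcal A[u^1,v^1,\theta,q,u^2,v^2]=\Big[u^2,\ v^2,\ -(kq+mu^2)_x,\ -\tfrac{k}{\tau}\theta_x-\tfrac1\tau q,\ (au^1_x-m\theta)_x,\ b\,v^1_{xx}\Big]$$ (derivatives in the sense of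 distributions) on the domain $$D(\mathcal A)=\big\{U\in\mathcal H\ :\ \mathcal AU\in\mathcal H,\ a u^1_x(L_i)-m\theta(L_i)=b v^1_x(L_i),\ q(L_i)=0,\ i=1,2\big\}.$$ Here point values are those of the continuous representatives; $U,\mathcal AU\in\mathcal H$ implies that $u^1_x,\theta,q\in H^1(I)$ and $v^1_x\in H^1(O)$. Then $\mathcal H$ is a Hilbert space (i.e. complete), $D(\mathcal A)$ is dense in $\mathcal H$, $\mathcal A$ is closed, and $\mathcal A$ is the generator of a strongly continuous contraction semigroup $(T(t))_{t\ge0}$ on $\mathcal H$. -/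

import Mathlib

open MeasureTheory Set Filter Topology
open scoped ContDiff NNReal

noncomputable section

namespace Cattaneo

/-! ### One-dimensional Sobolev spaces through weak derivatives -/

/-- The complex Hilbert space `L²(Ω)` of an open set `Ω ⊆ ℝ` (Lebesgue measure). -/
abbrev L2 (Ω : TopologicalSpace.Opens ℝ) : Type :=
  Lp ℂ 2 (volume.restrict (Ω : Set ℝ))

/-- `φ ∈ C_c^∞(Ω; ℝ)`. (Since real and imaginary parts of a test function are test functions,
real test functions suffice for complex-valued weak derivatives.) -/
structure IsTest (Ω : TopologicalSpace.Opens ℝ) (φ : ℝ → ℝ) : Prop where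
  smooth : ContDiff ℝ ∞ φ
  compact : HasCompactSupport φ
  supp : tsupport φ ⊆ Ω

/-- `g ∈ L²(Ω)` is the weak (distributional) derivative of `f ∈ L²(Ω)` on `Ω`. -/
def HasWeakDeriv (Ω : TopologicalSpace.Opens ℝ) (f g : L2 Ω) : Prop :=
  ∀ φ : ℝ → ℝ, IsTest Ω φ →
    ∫ x in (Ω : Set ℝ), deriv φ x • f x = - ∫ x in (Ω : Set ℝ), φ x • g x

lemma integrable_smul {Ω : TopologicalSpace.Opens ℝ} {ψ : ℝ → ℝ} (hc : Continuous ψ)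
    (hs : HasCompactSupport ψ) (f : L2 Ω) :
    Integrable (fun x => ψ x • f x) (volume.restrict (Ω : Set ℝ)) := by
  have h1 : MemLp ψ 2 (volume.restrict (Ω : Set ℝ)) := 
    (hc.memLp_of_hasCompactSupport (μ := volume) hs).restrict _
  exact memLp_one_iff_integrable.1 ((Lp.memLp f).smul (r := 1) h1)

lemma IsTest.integrable {Ω : TopologicalSpace.Opens ℝ} {φ : ℝ → ℝ} (h : IsTest Ω φ) (f : L2 Ω) :
    Integrable (fun x => φ x • f x) (volume.restrict (Ω : Set ℝ)) :=
  integrable_smul h.smooth.continuous h.compact f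

lemma IsTest.integrable_deriv {Ω : TopologicalSpace.Opens ℝ} {φ : ℝ → ℝ} (h : IsTest Ω φ)
    (f : L2 Ω) : Integrable (fun x => deriv φ x • f x) (volume.restrict (Ω : Set ℝ)) :=
  integrable_smul (h.smooth.continuous_deriv (by simp)) h.compact.deriv f

lemma integral_smul_add {Ω : TopologicalSpace.Opens ℝ} {ψ : ℝ → ℝ} (hc : Continuous ψ)
    (hs : HasCompactSupport ψ) (f g : L2 Ω) :
    ∫ x in (Ω : Set ℝ), ψ x • (f + g : L2 Ω) x
      = (∫ x in (Ω : Set ℝ), ψ x • f x) + ∫ x in (Ω : Set ℝ), ψ x • g x := by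
  rw [← integral_add (integrable_smul hc hs f) (integrable_smul hc hs g)]
  apply integral_congr_ae
  filter_upwards [Lp.coeFn_add f g] with x hx
  rw [hx, Pi.add_apply, smul_add]

lemma integral_smul_smul {Ω : TopologicalSpace.Opens ℝ} (ψ : ℝ → ℝ) (c : ℂ) (f : L2 Ω) :
    ∫ x in (Ω : Set ℝ), ψ x • (c • f : L2 Ω) x = c • ∫ x in (Ω : Set ℝ), ψ x • f x := by
  rw [← integral_smul]
  apply integral_congr_ae
  filter_upwards [Lp.coeFn_smul c f] with x hx
  rw [hx, Pi.smul_apply, smul_comm]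

lemma HasWeakDeriv.add {Ω : TopologicalSpace.Opens ℝ} {f g f' g' : L2 Ω}
    (hf : HasWeakDeriv Ω f f') (hg : HasWeakDeriv Ω g g') :
    HasWeakDeriv Ω (f + g) (f' + g') := by
  intro φ h
  rw [integral_smul_add (h.smooth.continuous_deriv (by simp)) h.compact.deriv,
    integral_smul_add h.smooth.continuous h.compact, hf φ h, hg φ h, neg_add]

lemma HasWeakDeriv.smul {Ω : TopologicalSpace.Opens ℝ} {f f' : L2 Ω} (c : ℂ)
    (hf : HasWeakDeriv Ω f f') : HasWeakDeriv Ω (c • f) (c • f') := by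
  intro φ h
  rw [integral_smul_smul, integral_smul_smul, hf φ h, smul_neg]

lemma HasWeakDeriv.zero (Ω : TopologicalSpace.Opens ℝ) : HasWeakDeriv Ω 0 0 := by
  have : ∀ ψ : ℝ → ℝ, ∫ x in (Ω : Set ℝ), ψ x • (0 : L2 Ω) x = 0 := by
    intro ψ
    have h := integral_smul_smul (Ω := Ω) ψ 0 0
    rwa [zero_smul, zero_smul] at h
  intro φ _
  rw [this, this, neg_zero]

/-- An `L²` function whose integral against every test function vanishes is zero. -/
lemma eq_zero_of_test {Ω : TopologicalSpace.Opens ℝ} {f : L2 Ω}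
    (h : ∀ φ, IsTest Ω φ → ∫ x in (Ω : Set ℝ), φ x • f x = 0) : f = 0 := by
  have hloc : LocallyIntegrableOn (f : ℝ → ℂ) (Ω : Set ℝ) volume :=
    (locallyIntegrableOn_of_locallyIntegrable_restrict
      ((Lp.memLp f).locallyIntegrable (by norm_num)))
  have := Ω.isOpen.ae_eq_zero_of_integral_contDiff_smul_eq_zero hloc (by
    intro φ h1 h2 h3
    rw [← h φ ⟨h1, h2, h3⟩]
    symm
    apply setIntegral_eq_integral_of_forall_compl_eq_zero
    intro x hx
    rw [image_eq_zero_of_notMem_tsupport (fun hx' => hx (h3 hx')), zero_smul])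
  rw [Lp.eq_zero_iff_ae_eq_zero]
  exact (ae_restrict_iff' Ω.isOpen.measurableSet).2 this

/-- Weak derivatives are unique. -/
lemma HasWeakDeriv.unique {Ω : TopologicalSpace.Opens ℝ} {f g g' : L2 Ω}
    (h : HasWeakDeriv Ω f g) (h' : HasWeakDeriv Ω f g') : g = g' := by
  have h0 : HasWeakDeriv Ω 0 (g + (-1 : ℂ) • g') := by
    have := h.add (h'.smul (-1))
    rwa [neg_one_smul ℂ f, add_neg_cancel] at this
  have : g + (-1 : ℂ) • g' = 0 := by
    apply eq_zero_of_test
    intro φ hφ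
    have h1 := h0 φ hφ
    have h2 := HasWeakDeriv.zero Ω φ hφ
    have h3 : ∫ x in (Ω : Set ℝ), φ x • (0 : L2 Ω) x = 0 := by
      have h := integral_smul_smul (Ω := Ω) φ 0 0
      rwa [zero_smul, zero_smul] at h
    rw [h2, h3, neg_zero] at h1
    exact neg_eq_zero.1 h1.symm
  rwa [neg_one_smul, ← sub_eq_add_neg, sub_eq_zero] at this

/-- The Sobolev space `H¹(Ω)`, as a subspace of `L²(Ω)`. -/
def H1 (Ω : TopologicalSpace.Opens ℝ) : Submodule ℂ (L2 Ω) where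
  carrier := {f | ∃ g, HasWeakDeriv Ω f g}
  add_mem' := fun ⟨_, h⟩ ⟨_, h'⟩ => ⟨_, h.add h'⟩
  zero_mem' := ⟨0, HasWeakDeriv.zero Ω⟩
  smul_mem' := fun c _ ⟨_, h⟩ => ⟨_, h.smul c⟩

/-- The weak derivative `∂ₓ : H¹(Ω) → L²(Ω)`. -/
def weakDeriv (Ω : TopologicalSpace.Opens ℝ) : H1 Ω →ₗ[ℂ] L2 Ω where
  toFun f := f.2.choose
  map_add' f g := (f + g).2.choose_spec.unique (f.2.choose_spec.add g.2.choose_spec)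
  map_smul' c f := (c • f).2.choose_spec.unique (f.2.choose_spec.smul c)

lemma weakDeriv_spec {Ω : TopologicalSpace.Opens ℝ} (f : H1 Ω) :
    HasWeakDeriv Ω f (weakDeriv Ω f) := f.2.choose_spec

/-- `f ∈ L²(Ω)` has a representative which is continuous on the closure of `Ω`, and the value of
this representative at `x` is `z`. For `f ∈ H¹(Ω)` with `Ω` a bounded interval (or a finite union
of bounded intervals at positive distance) and `x ∈ closure Ω`, such a `z` exists
and is unique: it is the boundary value `f(x)` given by the Sobolev embedding. -/
def HasTrace {Ω : TopologicalSpace.Opens ℝ} (f : L2 Ω) (x : ℝ) (z : ℂ) : Prop :=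
  ∃ g : ℝ → ℂ, ContinuousOn g (closure (Ω : Set ℝ)) ∧
    f =ᵐ[volume.restrict (Ω : Set ℝ)] g ∧ g x = z

lemma HasTrace.add {Ω : TopologicalSpace.Opens ℝ} {f f' : L2 Ω} {x : ℝ} {z z' : ℂ}
    (h : HasTrace f x z) (h' : HasTrace f' x z') : HasTrace (f + f') x (z + z') := by
  obtain ⟨g, hg, hfg, rfl⟩ := h
  obtain ⟨g', hg', hfg', rfl⟩ := h'
  exact ⟨g + g', hg.add hg', (Lp.coeFn_add f f').trans (hfg.add hfg'), rfl⟩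

lemma HasTrace.smul {Ω : TopologicalSpace.Opens ℝ} {f : L2 Ω} {x : ℝ} {z : ℂ} (c : ℂ)
    (h : HasTrace f x z) : HasTrace (c • f) x (c * z) := by
  obtain ⟨g, hg, hfg, rfl⟩ := h
  exact ⟨c • g, hg.const_smul c, (Lp.coeFn_smul c f).trans (hfg.const_smul c), rfl⟩

lemma HasTrace.zero (Ω : TopologicalSpace.Opens ℝ) (x : ℝ) : HasTrace (0 : L2 Ω) x 0 :=
  ⟨0, continuousOn_const, Lp.coeFn_zero _ _ _, rfl⟩

/-- A smooth function with compact support in `(c, d)` and zero mean is the derivative of a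
test function. -/
lemma exists_primitive {c d : ℝ} (hcd : c < d) {ψ : ℝ → ℝ} (h1 : ContDiff ℝ ∞ ψ)
    (h2 : HasCompactSupport ψ) (h3 : tsupport ψ ⊆ Ioo c d) (h0 : ∫ x, ψ x = 0) :
    ∃ Φ : ℝ → ℝ, ContDiff ℝ ∞ Φ ∧ HasCompactSupport Φ ∧ tsupport Φ ⊆ Ioo c d ∧ deriv Φ = ψ := by
  obtain ⟨c', d', hc', hd', hK⟩ : ∃ c' d', c < c' ∧ d' < d ∧ tsupport ψ ⊆ Icc c' d' := by
    rcases (tsupport ψ).eq_empty_or_nonempty with he | hne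
    · exact ⟨(c + d) / 2, (c + d) / 2, by linarith, by linarith, by simp [he]⟩
    · obtain ⟨p, hp, hp'⟩ := h2.isCompact.exists_isLeast hne
      obtain ⟨r, hr, hr'⟩ := h2.isCompact.exists_isGreatest hne
      exact ⟨p, r, (h3 hp).1, (h3 hr).2, fun x hx => ⟨hp' hx, hr' hx⟩⟩
  have hz : ∀ x, x ∉ Icc c' d' → ψ x = 0 := fun x hx =>
    image_eq_zero_of_notMem_tsupport fun h => hx (hK h)
  have hder : ∀ x, HasDerivAt (fun y => ∫ t in c..y, ψ t) (ψ x) x := fun x =>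
    intervalIntegral.integral_hasDerivAt_right (h1.continuous.intervalIntegrable _ _)
      (h1.continuous.stronglyMeasurableAtFilter _ _) h1.continuous.continuousAt
  have hd : deriv (fun y => ∫ t in c..y, ψ t) = ψ := funext fun x => (hder x).deriv
  have hsub : tsupport (fun y => ∫ t in c..y, ψ t) ⊆ Icc c' d' := by
    apply closure_minimal _ isClosed_Icc
    intro x hx
    by_contra hx'
    apply hx
    rcases lt_or_ge x c' with hlt | hge
    · have : ∫ t in c..x, ψ t = ∫ t in c..x, (0 : ℝ) := by
        apply intervalIntegral.integral_congr
        intro t ht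
        apply hz
        rintro ⟨ht1, -⟩
        have := ht.2
        rcases le_sup_iff.1 this with h | h <;> linarith
      simpa using this
    · have hlt : d' < x := by
        by_contra h
        exact hx' ⟨hge, not_lt.1 h⟩
      have hcx : c ≤ x := by linarith
      change ∫ t in c..x, ψ t = 0
      rw [intervalIntegral.integral_of_le hcx, ← h0]
      apply setIntegral_eq_integral_of_forall_compl_eq_zero
      intro t ht
      apply hz
      rintro ⟨ht1, ht2⟩
      exact ht ⟨by linarith, by linarith⟩
  refine ⟨_, ?_, isCompact_Icc.of_isClosed_subset (isClosed_tsupport _) hsub,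
    hsub.trans fun x hx => ⟨by linarith [hx.1], by linarith [hx.2]⟩, hd⟩
  rw [contDiff_infty_iff_deriv, hd]
  exact ⟨fun x => (hder x).differentiableAt, h1⟩

/-- A function with vanishing weak derivative is constant on every subinterval of `Ω`. -/
lemma HasWeakDeriv.ae_const {Ω : TopologicalSpace.Opens ℝ} {f : L2 Ω}
    (h : HasWeakDeriv Ω f 0) {c d : ℝ} (hcd : c < d) (hΩ : Ioo c d ⊆ (Ω : Set ℝ)) :
    ∃ C : ℂ, f =ᵐ[volume.restrict (Ioo c d)] fun _ => C := by
  let ρ : ContDiffBump ((c + d) / 2) :=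
    ⟨(d - c) / 8, (d - c) / 4, by linarith, by linarith⟩
  set η : ℝ → ℝ := ρ.normed volume with hη
  have hη1 : ContDiff ℝ ∞ η := ρ.contDiff_normed
  have hη2 : HasCompactSupport η := ρ.hasCompactSupport_normed
  have hη3 : tsupport η ⊆ Ioo c d := by
    rw [hη, ρ.tsupport_normed_eq, Real.closedBall_eq_Icc]
    intro x hx
    have e : ρ.rOut = (d - c) / 4 := rfl
    rw [e] at hx
    exact ⟨by linarith [hx.1], by linarith [hx.2]⟩
  have hη4 : ∫ x, η x = 1 := ρ.integral_normed
  have hzero : ∀ ψ : ℝ → ℝ, ∫ x in (Ω : Set ℝ), ψ x • (0 : L2 Ω) x = 0 := by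
    intro ψ
    have h := integral_smul_smul (Ω := Ω) ψ 0 0
    rwa [zero_smul, zero_smul] at h
  set C : ℂ := ∫ x in (Ω : Set ℝ), η x • f x with hC
  have key : ∀ φ : ℝ → ℝ, ContDiff ℝ ∞ φ → HasCompactSupport φ → tsupport φ ⊆ Ioo c d →
      ∫ x in (Ω : Set ℝ), φ x • f x = (∫ x, φ x) • C := by
    intro φ h1 h2 h3
    have hs : tsupport (fun x => φ x - (∫ y, φ y) * η x) ⊆ tsupport φ ∪ tsupport η := by
      apply closure_minimal _ ((isClosed_tsupport _).union (isClosed_tsupport _))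
      intro x hx
      by_contra hx'
      rw [mem_union, not_or] at hx'
      apply hx
      change φ x - (∫ y, φ y) * η x = 0
      rw [image_eq_zero_of_notMem_tsupport hx'.1, image_eq_zero_of_notMem_tsupport hx'.2]
      ring
    obtain ⟨Φ, hΦ1, hΦ2, hΦ3, hΦ4⟩ := exists_primitive hcd
      (ψ := fun x => φ x - (∫ y, φ y) * η x) (h1.sub (contDiff_const.mul hη1))
      ((h2.isCompact.union hη2.isCompact).of_isClosed_subset (isClosed_tsupport _) hs)
      (hs.trans (union_subset h3 hη3)) (by
        rw [integral_sub (h1.continuous.integrable_of_hasCompactSupport h2)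
          ((hη1.continuous.integrable_of_hasCompactSupport hη2).const_mul _),
          integral_const_mul, hη4]
        ring)
    have h4 := h Φ ⟨hΦ1, hΦ2, hΦ3.trans hΩ⟩
    rw [hzero, neg_zero, hΦ4] at h4
    have h5 : ∫ x in (Ω : Set ℝ), (φ x - (∫ y, φ y) * η x) • f x
        = (∫ x in (Ω : Set ℝ), φ x • f x) - ∫ x in (Ω : Set ℝ), (∫ y, φ y) • (η x • f x) := by
      have hi : Integrable (fun x => (∫ y, φ y) • (η x • f x)) (volume.restrict (Ω : Set ℝ)) :=
        by
        simpa only [Pi.smul_def] using (integrable_smul hη1.continuous hη2 f).smul (∫ y, φ y)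
      rw [← integral_sub (integrable_smul h1.continuous h2 f) hi]
      congr 1
      funext x
      rw [sub_smul, mul_smul]
    rw [h5, integral_smul, sub_eq_zero] at h4
    exact h4
  refine ⟨C, ?_⟩
  have hloc : LocallyIntegrableOn (fun x => f x - C) (Ioo c d) volume := by
    apply LocallyIntegrableOn.sub
    · exact (locallyIntegrableOn_of_locallyIntegrable_restrict
        ((Lp.memLp f).locallyIntegrable (by norm_num))).mono_set hΩ
    · exact (locallyIntegrable_const C).locallyIntegrableOn _
  have := isOpen_Ioo.ae_eq_zero_of_integral_contDiff_smul_eq_zero hloc (by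
    intro φ h1 h2 h3
    have e1 : ∫ x, φ x • (f x - C) = ∫ x in (Ω : Set ℝ), φ x • (f x - C) := by
      symm
      apply setIntegral_eq_integral_of_forall_compl_eq_zero
      intro x hx
      rw [image_eq_zero_of_notMem_tsupport (fun hx' => hx (hΩ (h3 hx'))), zero_smul]
    have hφi := (h1.continuous.integrable_of_hasCompactSupport (μ := volume) h2)
    have e2 : ∫ x in (Ω : Set ℝ), φ x • C = (∫ x, φ x) • C := by
      rw [← integral_smul_const]
      apply setIntegral_eq_integral_of_forall_compl_eq_zero
      intro x hx
      rw [image_eq_zero_of_notMem_tsupport (fun hx' => hx (hΩ (h3 hx'))), zero_smul]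
    rw [e1]
    simp_rw [smul_sub]
    rw [integral_sub (integrable_smul h1.continuous h2 f) (hφi.smul_const C).integrableOn,
      key φ h1 h2 h3, e2, sub_self])
  filter_upwards [(ae_restrict_iff' measurableSet_Ioo).2 this] with x hx
  exact sub_eq_zero.1 hx

/-- If moreover the trace at an endpoint of the subinterval vanishes, so does the function. -/
lemma HasWeakDeriv.ae_eq_trace {Ω : TopologicalSpace.Opens ℝ} {f : L2 Ω}
    (h : HasWeakDeriv Ω f 0) {c d : ℝ} (hcd : c < d) (hΩ : Ioo c d ⊆ (Ω : Set ℝ)) {x : ℝ}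
    (hx : x ∈ Icc c d) {z : ℂ} (hz : HasTrace f x z) :
    f =ᵐ[volume.restrict (Ioo c d)] fun _ => z := by
  obtain ⟨C, hC⟩ := h.ae_const hcd hΩ
  obtain ⟨g, hg, hfg, rfl⟩ := hz
  have hcl : Icc c d ⊆ closure (Ω : Set ℝ) := by
    rw [← closure_Ioo hcd.ne]
    exact closure_mono hΩ
  have hgC : g =ᵐ[volume.restrict (Icc c d)] fun _ => C := by
    rw [← restrict_Ioo_eq_restrict_Icc]
    have h1 : f =ᵐ[volume.restrict (Ioo c d)] g := ae_restrict_of_ae_restrict_of_subset hΩ hfg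
    exact h1.symm.trans hC
  have := Measure.eqOn_Icc_of_ae_eq volume hcd.ne hgC (hg.mono hcl) continuousOn_const
  rw [this hx]
  exact hC

/-! ### The energy space -/

/-- The data of an elastic-thermoelastic-elastic bar: the interfaces `0 < L₁ < L₂ < L₃` and the
strictly positive material parameters. -/
structure Bar where
  (L₁ L₂ L₃ a b m k τ : ℝ)
  L₁_pos : 0 < L₁
  L₁_lt_L₂ : L₁ < L₂
  L₂_lt_L₃ : L₂ < L₃
  a_pos : 0 < a
  b_pos : 0 < b
  m_pos : 0 < m
  k_pos : 0 < k
  τ_pos : 0 < τ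

namespace Bar

variable (P : Bar)

/-- The thermoelastic part `(L₁, L₂)`. -/
def mid : TopologicalSpace.Opens ℝ := ⟨Ioo P.L₁ P.L₂, isOpen_Ioo⟩

/-- The elastic part `(0, L₁) ∪ (L₂, L₃)`. -/
def outer : TopologicalSpace.Opens ℝ :=
  ⟨Ioo 0 P.L₁ ∪ Ioo P.L₂ P.L₃, isOpen_Ioo.union isOpen_Ioo⟩

/-- The condition on the pair `(u¹, v¹)` in the energy space: both components are `H¹`,
`v¹(0) = v¹(L₃) = 0` and `u¹(Lᵢ) = v¹(Lᵢ)` for `i = 1, 2`. -/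
structure IsDisplacement (u : L2 P.mid) (v : L2 P.outer) : Prop where
  u_mem : u ∈ H1 P.mid
  v_mem : v ∈ H1 P.outer
  left : HasTrace v 0 0
  right : HasTrace v P.L₃ 0
  interface₁ : ∃ z, HasTrace u P.L₁ z ∧ HasTrace v P.L₁ z
  interface₂ : ∃ z, HasTrace u P.L₂ z ∧ HasTrace v P.L₂ z

/-- Six-tuples `[u¹, v¹, θ, q, u², v²]` of `L²` functions. -/
abbrev Tuple : Type :=
  L2 P.mid × L2 P.outer × L2 P.mid × L2 P.mid × L2 P.mid × L2 P.outer

/-- The tuples `[u¹, v¹, θ, q, u², v²]` of the energy space. -/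
def stateSubmodule : Submodule ℂ P.Tuple where
  carrier := {U | P.IsDisplacement U.1 U.2.1}
  add_mem' := by
    rintro U V ⟨h1, h2, h3, h4, ⟨z, h5, h6⟩, ⟨w, h7, h8⟩⟩
      ⟨k1, k2, k3, k4, ⟨z', k5, k6⟩, ⟨w', k7, k8⟩⟩
    exact ⟨add_mem h1 k1, add_mem h2 k2, by simpa using h3.add k3, by simpa using h4.add k4,
      ⟨_, h5.add k5, h6.add k6⟩, ⟨_, h7.add k7, h8.add k8⟩⟩
  zero_mem' := ⟨zero_mem _, zero_mem _, .zero _ _, .zero _ _,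
    ⟨0, .zero _ _, .zero _ _⟩, ⟨0, .zero _ _, .zero _ _⟩⟩
  smul_mem' := by
    rintro c U ⟨h1, h2, h3, h4, ⟨z, h5, h6⟩, ⟨w, h7, h8⟩⟩
    exact ⟨Submodule.smul_mem _ c h1, Submodule.smul_mem _ c h2, by simpa using h3.smul c,
      by simpa using h4.smul c, ⟨_, h5.smul c, h6.smul c⟩, ⟨_, h7.smul c, h8.smul c⟩⟩

/-- The energy space `ℋ`. (A type of its own: its norm is the energy norm defined below and not
the one inherited from the product of the `L²` spaces.) -/
def EnergySpace : Type := P.stateSubmodule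

instance : AddCommGroup P.EnergySpace := inferInstanceAs (AddCommGroup P.stateSubmodule)

instance : Module ℂ P.EnergySpace := inferInstanceAs (Module ℂ P.stateSubmodule)

namespace EnergySpace

variable {P}

/-- The underlying six-tuple of `L²` functions. -/
def toTuple : P.EnergySpace →ₗ[ℂ] P.Tuple := P.stateSubmodule.subtype

lemma toTuple_injective : Function.Injective (toTuple (P := P)) :=
  P.stateSubmodule.injective_subtype

lemma isDisplacement (U : P.EnergySpace) : P.IsDisplacement U.toTuple.1 U.toTuple.2.1 :=
  Subtype.property (p := fun x => x ∈ P.stateSubmodule) U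

/-- The component `u¹`. -/
def u₁ : P.EnergySpace →ₗ[ℂ] L2 P.mid := LinearMap.fst ℂ _ _ ∘ₗ toTuple

/-- The component `v¹`. -/
def v₁ : P.EnergySpace →ₗ[ℂ] L2 P.outer := LinearMap.fst ℂ _ _ ∘ₗ LinearMap.snd ℂ _ _ ∘ₗ toTuple

/-- The component `θ`. -/
def θ : P.EnergySpace →ₗ[ℂ] L2 P.mid :=
  LinearMap.fst ℂ _ _ ∘ₗ LinearMap.snd ℂ _ _ ∘ₗ LinearMap.snd ℂ _ _ ∘ₗ toTuple

/-- The component `q`. -/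
def q : P.EnergySpace →ₗ[ℂ] L2 P.mid :=
  LinearMap.fst ℂ _ _ ∘ₗ LinearMap.snd ℂ _ _ ∘ₗ LinearMap.snd ℂ _ _ ∘ₗ LinearMap.snd ℂ _ _ ∘ₗ
    toTuple

/-- The component `u²`. -/
def u₂ : P.EnergySpace →ₗ[ℂ] L2 P.mid :=
  LinearMap.fst ℂ _ _ ∘ₗ LinearMap.snd ℂ _ _ ∘ₗ LinearMap.snd ℂ _ _ ∘ₗ LinearMap.snd ℂ _ _ ∘ₗ
    LinearMap.snd ℂ _ _ ∘ₗ toTuple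

/-- The component `v²`. -/
def v₂ : P.EnergySpace →ₗ[ℂ] L2 P.outer :=
  LinearMap.snd ℂ _ _ ∘ₗ LinearMap.snd ℂ _ _ ∘ₗ LinearMap.snd ℂ _ _ ∘ₗ LinearMap.snd ℂ _ _ ∘ₗ
    LinearMap.snd ℂ _ _ ∘ₗ toTuple

lemma ext_components {U V : P.EnergySpace} (h1 : u₁ U = u₁ V) (h2 : v₁ U = v₁ V) (h3 : θ U = θ V)
    (h4 : q U = q V) (h5 : u₂ U = u₂ V) (h6 : v₂ U = v₂ V) : U = V :=
  toTuple_injective (Prod.ext h1 (Prod.ext h2 (Prod.ext h3 (Prod.ext h4 (Prod.ext h5 h6)))))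

/-- The weak derivative `u¹ₓ`. -/
def du₁ : P.EnergySpace →ₗ[ℂ] L2 P.mid :=
  weakDeriv P.mid ∘ₗ u₁.codRestrict (H1 P.mid) fun U => U.isDisplacement.u_mem

/-- The weak derivative `v¹ₓ`. -/
def dv₁ : P.EnergySpace →ₗ[ℂ] L2 P.outer :=
  weakDeriv P.outer ∘ₗ v₁.codRestrict (H1 P.outer) fun U => U.isDisplacement.v_mem

lemma hasWeakDeriv_u₁ (U : P.EnergySpace) : HasWeakDeriv P.mid (u₁ U) (du₁ U) :=
  weakDeriv_spec (⟨u₁ U, U.isDisplacement.u_mem⟩ : H1 P.mid)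

lemma hasWeakDeriv_v₁ (U : P.EnergySpace) : HasWeakDeriv P.outer (v₁ U) (dv₁ U) :=
  weakDeriv_spec (⟨v₁ U, U.isDisplacement.v_mem⟩ : H1 P.outer)

/-- A state of zero elastic energy has zero displacement. -/
lemma displacement_eq_zero {U : P.EnergySpace} (hu : du₁ U = 0) (hv : dv₁ U = 0) :
    u₁ U = 0 ∧ v₁ U = 0 := by
  have wu := hasWeakDeriv_u₁ U
  have wv := hasWeakDeriv_v₁ U
  rw [hu] at wu
  rw [hv] at wv
  have hD : P.IsDisplacement (u₁ U) (v₁ U) := U.isDisplacement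
  have hl : (v₁ U : ℝ → ℂ) =ᵐ[volume.restrict (Ioo 0 P.L₁)] fun _ => 0 :=
    wv.ae_eq_trace P.L₁_pos subset_union_left (left_mem_Icc.2 P.L₁_pos.le) hD.left
  have hr : (v₁ U : ℝ → ℂ) =ᵐ[volume.restrict (Ioo P.L₂ P.L₃)] fun _ => 0 :=
    wv.ae_eq_trace P.L₂_lt_L₃ subset_union_right (right_mem_Icc.2 P.L₂_lt_L₃.le) hD.right
  have hv0 : v₁ U = 0 := by
    rw [Lp.eq_zero_iff_ae_eq_zero]
    exact (ae_restrict_union_iff _ _ _).2 ⟨hl, hr⟩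
  obtain ⟨z, hz, hz'⟩ := hD.interface₁
  have hz0 : z = 0 := by
    rw [hv0] at wv hz'
    have h1 := wv.ae_eq_trace P.L₁_pos subset_union_left (right_mem_Icc.2 P.L₁_pos.le) hz'
    have h2 := wv.ae_eq_trace P.L₁_pos subset_union_left (right_mem_Icc.2 P.L₁_pos.le)
      (HasTrace.zero P.outer P.L₁)
    have h3 : (fun _ : ℝ => z) =ᵐ[volume.restrict (Ioo 0 P.L₁)] fun _ => (0 : ℂ) := h1.symm.trans h2
    have h4 := Measure.eqOn_open_of_ae_eq h3 isOpen_Ioo continuousOn_const continuousOn_const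
    have h5 : P.L₁ / 2 ∈ Ioo 0 P.L₁ := ⟨by linarith [P.L₁_pos], by linarith [P.L₁_pos]⟩
    exact h4 h5
  refine ⟨?_, hv0⟩
  rw [Lp.eq_zero_iff_ae_eq_zero]
  have := wu.ae_eq_trace P.L₁_lt_L₂ subset_rfl (left_mem_Icc.2 P.L₁_lt_L₂.le) hz
  rw [hz0] at this
  exact this

/-- The energy inner product
`∫_{L₁}^{L₂} (a u¹ₓ ũ¹ₓ + u² ũ² + θ θ̃ + τ q q̃) dx + (∫₀^{L₁} + ∫_{L₂}^{L₃}) (b v¹ₓ ṽ¹ₓ + v² ṽ²) dx`,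
written with the `L²` inner products. Following Mathlib, the complex conjugate is taken on the first
argument. -/
def energyInner (U V : P.EnergySpace) : ℂ :=
  (P.a : ℂ) * inner ℂ (du₁ U) (du₁ V) + inner ℂ (u₂ U) (u₂ V) + inner ℂ (θ U) (θ V)
    + (P.τ : ℂ) * inner ℂ (q U) (q V)
    + (P.b : ℂ) * inner ℂ (dv₁ U) (dv₁ V) + inner ℂ (v₂ U) (v₂ V)

lemma energyInner_self (U : P.EnergySpace) :
    energyInner U U = ((P.a * ‖du₁ U‖ ^ 2 + ‖u₂ U‖ ^ 2 + ‖θ U‖ ^ 2 + P.τ * ‖q U‖ ^ 2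
      + P.b * ‖dv₁ U‖ ^ 2 + ‖v₂ U‖ ^ 2 : ℝ) : ℂ) := by
  simp only [energyInner, inner_self_eq_norm_sq_to_K]
  push_cast
  rfl

/-- The energy inner product is positive definite. -/
abbrev innerCore : InnerProductSpace.Core ℂ P.EnergySpace where
  inner := energyInner
  conj_inner_symm U V := by
    simp only [energyInner, map_add, map_mul, Complex.conj_ofReal, inner_conj_symm]
  re_inner_nonneg U := by
    rw [energyInner_self, RCLike.re_to_complex, Complex.ofReal_re]
    have := P.a_pos
    have := P.b_pos
    have := P.τ_pos
    positivity
  add_left U V W := by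
    simp only [energyInner, map_add, inner_add_left]
    ring
  smul_left U V c := by
    simp only [energyInner, map_smul, inner_smul_left]
    ring
  definite U h := by
    change energyInner U U = 0 at h
    rw [energyInner_self, Complex.ofReal_eq_zero] at h
    have ha := P.a_pos
    have hb := P.b_pos
    have hτ := P.τ_pos
    have h1 : 0 ≤ P.a * ‖du₁ U‖ ^ 2 := by positivity
    have h2 : 0 ≤ P.τ * ‖q U‖ ^ 2 := by positivity
    have h3 : 0 ≤ P.b * ‖dv₁ U‖ ^ 2 := by positivity
    have h4 := sq_nonneg ‖u₂ U‖
    have h5 := sq_nonneg ‖θ U‖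
    have h6 := sq_nonneg ‖v₂ U‖
    have e1 : P.a * ‖du₁ U‖ ^ 2 = 0 := by linarith
    have e2 : P.τ * ‖q U‖ ^ 2 = 0 := by linarith
    have e3 : P.b * ‖dv₁ U‖ ^ 2 = 0 := by linarith
    have e4 : ‖u₂ U‖ ^ 2 = 0 := by linarith
    have e5 : ‖θ U‖ ^ 2 = 0 := by linarith
    have e6 : ‖v₂ U‖ ^ 2 = 0 := by linarith
    simp only [mul_eq_zero, ha.ne', hb.ne', hτ.ne', false_or, ne_eq, OfNat.ofNat_ne_zero,
      not_false_eq_true, pow_eq_zero_iff, norm_eq_zero] at e1 e2 e3 e4 e5 e6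
    obtain ⟨f1, f2⟩ := displacement_eq_zero e1 e3
    exact ext_components (by rw [f1, map_zero]) (by rw [f2, map_zero]) (by rw [e5, map_zero])
      (by rw [e2, map_zero]) (by rw [e4, map_zero]) (by rw [e6, map_zero])

/-- The energy norm `‖U‖² = ⟨U, U⟩`. -/
instance : NormedAddCommGroup P.EnergySpace := innerCore.toNormedAddCommGroup

instance : InnerProductSpace ℂ P.EnergySpace := InnerProductSpace.ofCore innerCore.toCore

end EnergySpace

/-! ### The operator of the Cattaneo model -/

open EnergySpace

/-- `𝒜 U = F` in the sense of distributions, row by row: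
`F = [u², v², -(k q + m u²)ₓ, -(k/τ) θₓ - q/τ, (a u¹ₓ - m θ)ₓ, b v¹ₓₓ]`. -/
structure IsImage (U F : P.EnergySpace) : Prop where
  row₁ : u₁ F = u₂ U
  row₂ : v₁ F = v₂ U
  row₃ : HasWeakDeriv P.mid (-((P.k : ℂ) • q U + (P.m : ℂ) • u₂ U)) (θ F)
  row₄ : HasWeakDeriv P.mid (-((P.k / P.τ : ℂ) • θ U)) (q F + (1 / P.τ : ℂ) • q U)
  row₅ : HasWeakDeriv P.mid ((P.a : ℂ) • du₁ U - (P.m : ℂ) • θ U) (u₂ F)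
  row₆ : HasWeakDeriv P.outer ((P.b : ℂ) • dv₁ U) (v₂ F)

/-- The matching of the forces at an interface `x`: `a u¹ₓ(x) - m θ(x) = b v¹ₓ(x)`. -/
def ForceMatching (U : P.EnergySpace) (x : ℝ) : Prop :=
  ∃ s t r : ℂ, HasTrace (du₁ U) x s ∧ HasTrace (θ U) x t ∧ HasTrace (dv₁ U) x r ∧
    P.a * s - P.m * t = P.b * r

/-- The transmission and boundary conditions in the domain of `𝒜`:
`a u¹ₓ(Lᵢ) - m θ(Lᵢ) = b v¹ₓ(Lᵢ)` and `q(Lᵢ) = 0` for `i = 1, 2`. -/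
structure BoundaryConditions (U : P.EnergySpace) : Prop where
  force₁ : P.ForceMatching U P.L₁
  force₂ : P.ForceMatching U P.L₂
  flux₁ : HasTrace (q U) P.L₁ 0
  flux₂ : HasTrace (q U) P.L₂ 0

variable {P}

lemma IsImage.add {U V F G : P.EnergySpace} (h : P.IsImage U F) (h' : P.IsImage V G) :
    P.IsImage (U + V) (F + G) where
  row₁ := by rw [map_add, map_add, h.row₁, h'.row₁]
  row₂ := by rw [map_add, map_add, h.row₂, h'.row₂]
  row₃ := by
    convert h.row₃.add h'.row₃ using 1
    · simp only [map_add, smul_add]; abel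
    · rw [map_add]
  row₄ := by
    convert h.row₄.add h'.row₄ using 1
    · simp only [map_add, smul_add]; abel
    · simp only [map_add, smul_add]; abel
  row₅ := by
    convert h.row₅.add h'.row₅ using 1
    · simp only [map_add, smul_add]; abel
    · rw [map_add]
  row₆ := by
    convert h.row₆.add h'.row₆ using 1
    · simp only [map_add, smul_add]
    · rw [map_add]

lemma IsImage.smul {U F : P.EnergySpace} (c : ℂ) (h : P.IsImage U F) :
    P.IsImage (c • U) (c • F) where
  row₁ := by rw [map_smul, map_smul, h.row₁]
  row₂ := by rw [map_smul, map_smul, h.row₂]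
  row₃ := by
    convert h.row₃.smul c using 1
    · simp only [map_smul, smul_add, smul_neg, smul_comm c]
    · rw [map_smul]
  row₄ := by
    convert h.row₄.smul c using 1
    · simp only [map_smul, smul_neg, smul_comm c]
    · simp only [map_smul, smul_add, smul_comm c]
  row₅ := by
    convert h.row₅.smul c using 1
    · simp only [map_smul, smul_sub, smul_comm c]
    · rw [map_smul]
  row₆ := by
    convert h.row₆.smul c using 1
    · simp only [map_smul, smul_comm c]
    · rw [map_smul]

lemma IsImage.unique {U F G : P.EnergySpace} (h : P.IsImage U F) (h' : P.IsImage U G) : F = G :=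
  ext_components (h.row₁.trans h'.row₁.symm) (h.row₂.trans h'.row₂.symm)
    (h.row₃.unique h'.row₃) (add_right_cancel (h.row₄.unique h'.row₄))
    (h.row₅.unique h'.row₅) (h.row₆.unique h'.row₆)

lemma IsImage.zero : P.IsImage 0 0 := by
  constructor <;> simp [HasWeakDeriv.zero]

lemma ForceMatching.add {U V : P.EnergySpace} {x : ℝ} (h : P.ForceMatching U x)
    (h' : P.ForceMatching V x) : P.ForceMatching (U + V) x := by
  obtain ⟨s, t, r, h1, h2, h3, h4⟩ := h
  obtain ⟨s', t', r', k1, k2, k3, k4⟩ := h'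
  refine ⟨s + s', t + t', r + r', ?_, ?_, ?_, by linear_combination h4 + k4⟩
  · rw [map_add]; exact h1.add k1
  · rw [map_add]; exact h2.add k2
  · rw [map_add]; exact h3.add k3

lemma ForceMatching.smul {U : P.EnergySpace} {x : ℝ} (c : ℂ) (h : P.ForceMatching U x) :
    P.ForceMatching (c • U) x := by
  obtain ⟨s, t, r, h1, h2, h3, h4⟩ := h
  refine ⟨c * s, c * t, c * r, ?_, ?_, ?_, by linear_combination c * h4⟩
  · rw [map_smul]; exact h1.smul c
  · rw [map_smul]; exact h2.smul c
  · rw [map_smul]; exact h3.smul c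

lemma ForceMatching.zero (x : ℝ) : P.ForceMatching 0 x :=
  ⟨0, 0, 0, by rw [map_zero]; exact .zero _ _, by rw [map_zero]; exact .zero _ _,
    by rw [map_zero]; exact .zero _ _, by simp⟩

lemma BoundaryConditions.add {U V : P.EnergySpace} (h : P.BoundaryConditions U)
    (h' : P.BoundaryConditions V) : P.BoundaryConditions (U + V) where
  force₁ := h.force₁.add h'.force₁
  force₂ := h.force₂.add h'.force₂
  flux₁ := by simpa using h.flux₁.add h'.flux₁
  flux₂ := by simpa using h.flux₂.add h'.flux₂

lemma BoundaryConditions.smul {U : P.EnergySpace} (c : ℂ) (h : P.BoundaryConditions U) :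
    P.BoundaryConditions (c • U) where
  force₁ := h.force₁.smul c
  force₂ := h.force₂.smul c
  flux₁ := by simpa using h.flux₁.smul c
  flux₂ := by simpa using h.flux₂.smul c

lemma BoundaryConditions.zero : P.BoundaryConditions 0 where
  force₁ := .zero _
  force₂ := .zero _
  flux₁ := by rw [map_zero]; exact .zero _ _
  flux₂ := by rw [map_zero]; exact .zero _ _

variable (P)

/-- The domain `D(𝒜)`: all `U ∈ ℋ` such that `𝒜 U ∈ ℋ` and such that the transmission and boundary
conditions hold. -/
def domain : Submodule ℂ P.EnergySpace where
  carrier := {U | (∃ F, P.IsImage U F) ∧ P.BoundaryConditions U}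
  add_mem' := fun ⟨⟨_, h⟩, k⟩ ⟨⟨_, h'⟩, k'⟩ => ⟨⟨_, h.add h'⟩, k.add k'⟩
  zero_mem' := ⟨⟨0, .zero⟩, .zero⟩
  smul_mem' := fun c _ ⟨⟨_, h⟩, k⟩ => ⟨⟨_, h.smul c⟩, k.smul c⟩

/-- The unbounded operator `𝒜 : ℋ ⊇ D(𝒜) → ℋ`. -/
def operator : P.EnergySpace →ₗ.[ℂ] P.EnergySpace where
  domain := P.domain
  toFun :=
    { toFun := fun U => U.2.1.choose
      map_add' := fun U V =>
        (U + V).2.1.choose_spec.unique (U.2.1.choose_spec.add V.2.1.choose_spec)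
      map_smul' := fun c U => (c • U).2.1.choose_spec.unique (U.2.1.choose_spec.smul c) }

lemma isImage_operator (U : P.operator.domain) : P.IsImage U (P.operator U) :=
  U.2.1.choose_spec

/-- The graph of `𝒜`. -/
lemma mem_graph_operator {U F : P.EnergySpace} :
    (U, F) ∈ P.operator.graph ↔ P.IsImage U F ∧ P.BoundaryConditions U := by
  rw [LinearPMap.mem_graph_iff]
  constructor
  · rintro ⟨V, rfl, rfl⟩
    exact ⟨P.isImage_operator V, V.2.2⟩
  · rintro ⟨h, k⟩
    exact ⟨⟨U, ⟨F, h⟩, k⟩, rfl, (P.isImage_operator ⟨U, ⟨F, h⟩, k⟩).unique h⟩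

end Bar

/-! ### Strongly continuous semigroups -/

/-- `(T(t))_{t ≥ 0}` is a strongly continuous contraction semigroup on `X`. -/
structure IsContractionSemigroup {X : Type*} [NormedAddCommGroup X] [NormedSpace ℂ X]
    (T : ℝ≥0 → X →L[ℂ] X) : Prop where
  zero : T 0 = ContinuousLinearMap.id ℂ X
  add : ∀ s t, T (s + t) = (T s).comp (T t)
  continuous : ∀ x, Continuous fun t => T t x
  contraction : ∀ t, ‖T t‖ ≤ 1

/-- `A` is the (infinitesimal) generator of the semigroup `T`: the domain of `A` consists of exactly
those `x` for which `lim_{t ↓ 0} (T(t)x - x) / t` exists, and `A x` is this limit. -/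
def IsGenerator {X : Type*} [NormedAddCommGroup X] [NormedSpace ℂ X]
    (A : X →ₗ.[ℂ] X) (T : ℝ≥0 → X →L[ℂ] X) : Prop :=
  ∀ x y : X, (x, y) ∈ A.graph ↔
    Tendsto (fun t : ℝ≥0 => ((t : ℝ) : ℂ)⁻¹ • (T t x - x)) (𝓝[>] 0) (𝓝 y)

end Cattaneo

end

/-!
The operator `𝒜` is dissipative and `1 - 𝒜` is onto, so that the Lumer–Phillips theorem
applies; in a Hilbert space these two properties also imply that `𝒜` is closed and densely
defined.

*Semigroups.* Let `A` be dissipative with `1 - A` onto. Neumann series yield resolvents at a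
sequence `r → ∞`, and the Yosida approximations `r (r (r - A)⁻¹ - 1)` are commuting bounded
dissipative operators converging to `A` on its domain. Their exponentials are contractions and
converge strongly to a semigroup (`exists_semigroup_of_tendsto`), whose generator extends `A` and
hence equals `A` because `1 - A` is onto (`IsDissipative.exists_isGenerator`).

*Sobolev functions.* On every bounded interval, a weakly differentiable function has an absolutely
continuous representative (`HasWeakDeriv.exists_isPrimitive`), and integration by parts, which comes
down to Fubini's theorem, is valid with boundary values (`HasWeakDeriv.integral_conj_mul_add`).

*Completeness.* A state is determined by `(u¹ₓ, v¹ₓ, θ, q, u², v²)`, and such a tuple comes from a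
state iff `∫ u¹ₓ + ∫ v¹ₓ = 0` (`exists_isDisplacement`,
`EnergySpace.integral_derivative_eq_zero`).

*Dissipativity.* Integration by parts on the three intervals gives `Re ⟨𝒜 U, U⟩ = -‖q‖²`
(`re_inner_operator_eq`), the boundary terms being cancelled by the transmission conditions.

*Range.* Eliminating `u¹`, `v¹` and `θ` from `U - 𝒜 U = F` leaves a variational problem for the
velocity `z` and the heat flux `q`, whose form
`⟨z, ζ⟩ + a ⟨zₓ, ζₓ⟩_I + b ⟨zₓ, ζₓ⟩_O + (τ + 1) ⟨q, p⟩ + ⟨k qₓ + m zₓ, k pₓ + m ζₓ⟩`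
is Hermitian and coercive. Up to a rescaling of `q` it is the inner product of the energy space
restricted to a closed subspace (`variationSpace`), so that the problem is solved by an orthogonal
projection (`exists_sub_operator_eq`). The continuity of the force at the interfaces is the natural
boundary condition of this problem (`hasTrace_of_weakDefect`).
-/

noncomputable section
namespace Cattaneo

/-! ### Uniformly continuous contraction semigroups -/

section Exponential

open NormedSpace

variable {X : Type*} [NormedAddCommGroup X] [InnerProductSpace ℂ X] [CompleteSpace X]

lemma hasDerivAt_exp_smul_apply (B : X →L[ℂ] X) (x : X) (t : ℝ) :
    HasDerivAt (fun s : ℝ => exp (s • B) x) (exp (t • B) (B x)) t := by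
  have h := hasDerivAt_exp_smul_const (𝕂 := ℝ) B t
  have h2 := ((ContinuousLinearMap.apply ℂ X x).restrictScalars ℝ).hasFDerivAt.comp_hasDerivAt t h
  exact h2

/-- A bounded dissipative operator generates a contraction semigroup: the energy `‖exp (tB) x‖²` has
the nonpositive derivative `2 Re ⟨B u, u⟩`. -/
lemma norm_exp_smul_apply_le {B : X →L[ℂ] X} (hB : ∀ x, (inner ℂ (B x) x).re ≤ 0) {t : ℝ}
    (ht : 0 ≤ t) (x : X) : ‖exp (t • B) x‖ ≤ ‖x‖ := by
  let _ : InnerProductSpace ℝ X := InnerProductSpace.complexToReal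
  have hd : ∀ s : ℝ, HasDerivAt (fun s : ℝ => exp (s • B) x) (B (exp (s • B) x)) s := fun s => by
    have h := hasDerivAt_exp_smul_const' (𝕂 := ℝ) B s
    exact ((ContinuousLinearMap.apply ℂ X x).restrictScalars ℝ).hasFDerivAt.comp_hasDerivAt s h
  have hn := fun s => (hd s).norm_sq
  have hanti : Antitone fun s : ℝ => ‖exp (s • B) x‖ ^ 2 := by
    refine antitone_of_deriv_nonpos (fun s => (hn s).differentiableAt) fun s => ?_
    rw [(hn s).deriv]
    have h1 : inner ℝ (exp (s • B) x) (B (exp (s • B) x))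
        = (inner ℂ (exp (s • B) x) (B (exp (s • B) x))).re := rfl
    have h2 := hB (exp (s • B) x)
    rw [← inner_conj_symm, Complex.conj_re] at h2
    rw [h1]
    linarith
  have h0 := hanti ht
  simp only [zero_smul, exp_zero, one_apply_eq_self] at h0
  exact (sq_le_sq₀ (norm_nonneg _) (norm_nonneg _)).1 h0

/-- Two commuting contraction semigroups differ by at most `t` times the difference of their
generators: differentiate `s ↦ exp (sB) exp ((t - s)C) x`. -/
lemma norm_exp_smul_sub_exp_smul_le {B C : X →L[ℂ] X} (hBC : Commute B C)
    (hB : ∀ x, (inner ℂ (B x) x).re ≤ 0) (hC : ∀ x, (inner ℂ (C x) x).re ≤ 0) {t : ℝ}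
    (ht : 0 ≤ t) (x : X) : ‖exp (t • B) x - exp (t • C) x‖ ≤ t * ‖B x - C x‖ := by
  have hd : ∀ s : ℝ, HasDerivAt (fun s : ℝ => exp (s • B) (exp ((t - s) • C) x))
      (exp (s • B) (exp ((t - s) • C) (B x - C x))) s := fun s => by
    have h1 := hasDerivAt_exp_smul_const (𝕂 := ℝ) B s
    have h2 : HasDerivAt (fun s : ℝ => exp ((t - s) • C)) (-(exp ((t - s) • C) * C)) s := by
      have := (hasDerivAt_exp_smul_const (𝕂 := ℝ) C (t - s)).scomp s
        ((hasDerivAt_id s).const_sub t)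
      rw [neg_one_smul] at this
      exact this
    have h3 := h1.mul h2
    have h4 := ((ContinuousLinearMap.apply ℂ X x).restrictScalars ℝ).hasFDerivAt.comp_hasDerivAt s
      h3
    refine h4.congr_deriv ?_
    have hcomm : B * exp ((t - s) • C) = exp ((t - s) • C) * B :=
      ((hBC.smul_right (t - s)).exp_right).eq
    change (exp (s • B) * B * exp ((t - s) • C) + exp (s • B) * -(exp ((t - s) • C) * C)) x = _
    rw [mul_assoc, hcomm]
    simp [sub_eq_add_neg]
  have := norm_image_sub_le_of_norm_deriv_le_segment' (a := 0) (b := t) (C := ‖B x - C x‖)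
    (fun s _ => (hd s).hasDerivWithinAt) (fun s hs => by
      exact (norm_exp_smul_apply_le hB hs.1 _).trans
        (norm_exp_smul_apply_le hC (by linarith [hs.2]) _)) t (right_mem_Icc.2 ht)
  simpa [mul_comm] using this

lemma norm_exp_smul_sub_self_le {B : X →L[ℂ] X} (hB : ∀ x, (inner ℂ (B x) x).re ≤ 0) {t : ℝ}
    (ht : 0 ≤ t) (x : X) : ‖exp (t • B) x - x‖ ≤ t * ‖B x‖ := by
  simpa using norm_exp_smul_sub_exp_smul_le (Commute.zero_right B) hB (by simp) ht x

/-- A first order Taylor estimate. The vector `y` approximates `B x`, so that `‖B y‖` may stay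
bounded along a family of operators `B` although `‖B (B x)‖` does not. -/
lemma norm_exp_smul_sub_taylor_le {B : X →L[ℂ] X} (hB : ∀ x, (inner ℂ (B x) x).re ≤ 0) {t : ℝ}
    (ht : 0 ≤ t) (x y : X) :
    ‖exp (t • B) x - x - t • y‖ ≤ (t * ‖B y‖ + ‖B x - y‖) * t := by
  have hd : ∀ s : ℝ, HasDerivAt (fun s : ℝ => exp (s • B) x - s • y)
      (exp (s • B) (B x) - y) s := fun s => by
    have h2 : HasDerivAt (fun s : ℝ => s • y) y s := by
      simpa using (hasDerivAt_id s).smul_const y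
    exact (hasDerivAt_exp_smul_apply B x s).sub h2
  have := norm_image_sub_le_of_norm_deriv_le_segment' (a := 0) (b := t)
    (C := t * ‖B y‖ + ‖B x - y‖)
    (fun s _ => (hd s).hasDerivWithinAt) (fun s hs => by
      have e : exp (s • B) (B x) - y = (exp (s • B) y - y) + exp (s • B) (B x - y) := by
        rw [map_sub]; abel
      rw [e]
      refine (norm_add_le _ _).trans (add_le_add ?_ (norm_exp_smul_apply_le hB hs.1 _))
      exact (norm_exp_smul_sub_self_le hB hs.1 y).trans
        (mul_le_mul_of_nonneg_right hs.2.le (norm_nonneg _))) t (right_mem_Icc.2 ht)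
  simpa [sub_right_comm] using this

end Exponential

/-! ### Resolvents of dissipative operators -/

section Resolvent

variable {X : Type*} [NormedAddCommGroup X] [InnerProductSpace ℂ X]

/-- `A` is dissipative: `Re ⟨A x, x⟩ ≤ 0` on the domain of `A`. -/
def IsDissipative (A : X →ₗ.[ℂ] X) : Prop :=
  ∀ x y, (x, y) ∈ A.graph → (inner ℂ y x).re ≤ 0

/-- `R` is a bounded right inverse of `r - A`: for every `y`, the vector `R y` lies in the domain
of `A` and `A (R y) = r • R y - y`. For `A` dissipative and `r > 0` it is the resolvent of `A` at
`r`. -/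
def IsResolvent (A : X →ₗ.[ℂ] X) (r : ℝ) (R : X →L[ℂ] X) : Prop :=
  ∀ y, (R y, (r : ℂ) • R y - y) ∈ A.graph

variable {A : X →ₗ.[ℂ] X}

lemma IsDissipative.norm_le (hA : IsDissipative A) {r : ℝ} {x y : X}
    (h : (x, y) ∈ A.graph) : r * ‖x‖ ≤ ‖(r : ℂ) • x - y‖ := by
  rcases eq_or_ne x 0 with rfl | hx
  · simp
  have hx' : 0 < ‖x‖ := norm_pos_iff.2 hx
  have h1 := hA x y h
  have h2 : r * ‖x‖ ^ 2 ≤ (inner ℂ ((r : ℂ) • x - y) x).re := by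
    have h3 : (inner ℂ x x).re = ‖x‖ * ‖x‖ := inner_self_eq_norm_mul_norm (𝕜 := ℂ) x
    rw [inner_sub_left, inner_smul_left, Complex.sub_re, Complex.conj_ofReal,
      Complex.re_ofReal_mul, h3]
    linarith
  have h3 : (inner ℂ ((r : ℂ) • x - y) x).re ≤ ‖(r : ℂ) • x - y‖ * ‖x‖ :=
    (Complex.re_le_norm _).trans (norm_inner_le_norm _ _)
  nlinarith

lemma IsDissipative.eq_zero (hA : IsDissipative A) {r : ℝ} (hr : 0 < r) {x y : X}
    (h : (x, y) ∈ A.graph) (h0 : (r : ℂ) • x - y = 0) : x = 0 := by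
  have := hA.norm_le (r := r) h
  rw [h0, norm_zero] at this
  exact norm_le_zero_iff.1 (nonpos_of_mul_nonpos_right this hr)

/-- The resolvent is a left inverse of `r - A`. -/
lemma IsResolvent.apply_sub (hA : IsDissipative A) {r : ℝ} (hr : 0 < r) {R : X →L[ℂ] X}
    (hR : IsResolvent A r R) {x y : X} (h : (x, y) ∈ A.graph) : R ((r : ℂ) • x - y) = x := by
  have h1 := A.graph.sub_mem (hR ((r : ℂ) • x - y)) h
  refine sub_eq_zero.1 (hA.eq_zero hr h1 ?_)
  change (r : ℂ) • (R ((r : ℂ) • x - y) - x)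
    - ((r : ℂ) • R ((r : ℂ) • x - y) - ((r : ℂ) • x - y) - y) = 0
  rw [smul_sub]
  abel

lemma IsResolvent.norm_apply_le (hA : IsDissipative A) {r : ℝ} {R : X →L[ℂ] X}
    (hR : IsResolvent A r R) (y : X) : r * ‖R y‖ ≤ ‖y‖ := by
  simpa using hA.norm_le (r := r) (hR y)

lemma IsDissipative.exists_isResolvent_one (hA : IsDissipative A)
    (hsurj : ∀ y, ∃ x, (x, x - y) ∈ A.graph) : ∃ R, IsResolvent A 1 R := by
  choose R hR using hsurj
  have hinj : ∀ {x x' y : X}, (x, x - y) ∈ A.graph → (x', x' - y) ∈ A.graph → x = x' := by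
    intro x x' y h h'
    have h1 := A.graph.sub_mem h h'
    refine sub_eq_zero.1 (hA.eq_zero one_pos h1 ?_)
    simp
  let R' : X →ₗ[ℂ] X :=
    { toFun := R
      map_add' := fun y z => hinj (hR _) (by
        convert A.graph.add_mem (hR y) (hR z) using 1
        rw [Prod.mk_add_mk, add_sub_add_comm])
      map_smul' := fun c y => hinj (hR _) (by
        convert A.graph.smul_mem c (hR y) using 1
        simp [smul_sub]) }
  refine ⟨R'.mkContinuous 1 fun y => ?_, fun y => ?_⟩
  · have := hA.norm_le (r := 1) (hR y)
    rw [Complex.ofReal_one, one_smul, sub_sub_cancel, one_mul] at this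
    rw [one_mul]
    exact this
  · change (R y, ((1 : ℝ) : ℂ) • R y - y) ∈ A.graph
    rw [Complex.ofReal_one, one_smul]
    exact hR y

/-- The Neumann series `R (1 + (s - r) R)⁻¹` extends the resolvent from `r` to `s`. -/
lemma IsResolvent.exists_near [CompleteSpace X] (hA : IsDissipative A) {r s : ℝ} {R : X →L[ℂ] X}
    (hR : IsResolvent A r R) (hr : 0 < r) (hs : |r - s| < r) : ∃ R', IsResolvent A s R' := by
  have hn : ‖R‖ ≤ r⁻¹ := R.opNorm_le_bound (by positivity) fun y => by
    have := hR.norm_apply_le hA y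
    rwa [inv_mul_eq_div, le_div_iff₀' hr]
  have hlt : ‖((r - s : ℝ) : ℂ) • R‖ < 1 := by
    rw [norm_smul, Complex.norm_real, Real.norm_eq_abs]
    calc |r - s| * ‖R‖ ≤ |r - s| * r⁻¹ := by gcongr
      _ < r * r⁻¹ := by gcongr
      _ = 1 := mul_inv_cancel₀ hr.ne'
  obtain ⟨u, hu⟩ := isUnit_one_sub_of_norm_lt_one hlt
  have huv : ∀ y, ((u⁻¹ : (X →L[ℂ] X)ˣ) : X →L[ℂ] X) y - ((r - s : ℝ) : ℂ) •
      R (((u⁻¹ : (X →L[ℂ] X)ˣ) : X →L[ℂ] X) y) = y := fun y => by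
    have h := congrArg (fun f : X →L[ℂ] X => f y) u.mul_inv
    rw [hu] at h
    simpa using h
  refine ⟨R * (u⁻¹ : (X →L[ℂ] X)ˣ), fun y => ?_⟩
  have h1 := hR (((u⁻¹ : (X →L[ℂ] X)ˣ) : X →L[ℂ] X) y)
  have h2 := huv y
  set v := ((u⁻¹ : (X →L[ℂ] X)ˣ) : X →L[ℂ] X) y
  change (R v, (s : ℂ) • R v - y) ∈ A.graph
  convert h1 using 2
  rw [← h2]
  push_cast
  rw [sub_smul]
  abel

/-- The resolvent exists along a sequence tending to infinity. The steps of length `1/2` stay within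
the radius of convergence of the Neumann series, which is at least `1`. -/
lemma IsDissipative.exists_isResolvent [CompleteSpace X] (hA : IsDissipative A)
    (hsurj : ∀ y, ∃ x, (x, x - y) ∈ A.graph) (n : ℕ) : ∃ R, IsResolvent A (1 + n / 2) R := by
  induction n with
  | zero => simpa using hA.exists_isResolvent_one hsurj
  | succ n ih =>
    obtain ⟨R, hR⟩ := ih
    refine hR.exists_near hA (by positivity) ?_
    push_cast
    have : (1 + (n : ℝ) / 2) - (1 + ((n : ℝ) + 1) / 2) = -(1 / 2) := by ring
    rw [this, abs_neg, abs_of_pos (by norm_num)]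
    have : (0 : ℝ) ≤ n := Nat.cast_nonneg n
    linarith

lemma IsResolvent.commute (hA : IsDissipative A) {r s : ℝ} (hr : 0 < r) (hs : 0 < s)
    {R S : X →L[ℂ] X} (hR : IsResolvent A r R) (hS : IsResolvent A s S) : Commute R S := by
  -- The resolvent identity.
  have key : ∀ {r s : ℝ} {R S : X →L[ℂ] X}, 0 < r → IsResolvent A r R → IsResolvent A s S →
      ∀ y, R y + ((r - s : ℝ) : ℂ) • R (S y) = S y := by
    intro r s R S hr hR hS y
    have := hR.apply_sub hA hr (hS y)
    rw [← map_smul, ← map_add]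
    convert this using 2
    push_cast
    rw [sub_smul]
    abel
  ext y
  change R (S y) = S (R y)
  have h1 := key hr hR hS
  have h2 := key hs hS hR y
  rcases eq_or_ne r s with rfl | hne
  · have hRS : ∀ z, R z = S z := fun z => by simpa using h1 z
    rw [hRS, hRS]
  · have h0 : ((r - s : ℝ) : ℂ) ≠ 0 := Complex.ofReal_ne_zero.2 (sub_ne_zero.2 hne)
    have h3 := h1 y
    apply smul_right_injective X h0
    have e1 : ((r - s : ℝ) : ℂ) • R (S y) = S y - R y := eq_sub_of_add_eq' h3
    have e2 : ((s - r : ℝ) : ℂ) • S (R y) = R y - S y := eq_sub_of_add_eq' h2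
    have e3 : ((r - s : ℝ) : ℂ) • S (R y) = -(((s - r : ℝ) : ℂ) • S (R y)) := by
      rw [← neg_smul]; push_cast; ring_nf
    change ((r - s : ℝ) : ℂ) • R (S y) = ((r - s : ℝ) : ℂ) • S (R y)
    rw [e1, e3, e2, neg_sub]

/-- The Yosida approximation `r (r R - 1)` of `A`. -/
def yosida (r : ℝ) (R : X →L[ℂ] X) : X →L[ℂ] X :=
  (r : ℂ) • ((r : ℂ) • R - 1)

lemma yosida_apply (r : ℝ) (R : X →L[ℂ] X) (x : X) :
    yosida r R x = (r : ℂ) • ((r : ℂ) • R x - x) := by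
  simp [yosida]

lemma commute_yosida {R S : X →L[ℂ] X} (h : Commute R S) (r s : ℝ) :
    Commute (yosida r R) (yosida s S) :=
  have h1 : Commute ((r : ℂ) • R - 1) ((s : ℂ) • S - 1) :=
    (((h.smul_left (r : ℂ)).smul_right (s : ℂ)).sub_right (Commute.one_right _)).sub_left
      (Commute.one_left _)
  (h1.smul_left (r : ℂ)).smul_right (s : ℂ)

lemma IsResolvent.yosida_eq (hA : IsDissipative A) {r : ℝ} (hr : 0 < r) {R : X →L[ℂ] X}
    (hR : IsResolvent A r R) {x y : X} (h : (x, y) ∈ A.graph) : yosida r R x = (r : ℂ) • R y := by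
  have h1 := hR.apply_sub hA hr h
  rw [yosida_apply]
  congr 1
  rw [← map_smul]
  nth_rewrite 2 [← h1]
  rw [← map_sub]
  congr 1
  abel

lemma IsResolvent.yosida_dissipative (hA : IsDissipative A) {r : ℝ} (hr : 0 < r) {R : X →L[ℂ] X}
    (hR : IsResolvent A r R) (x : X) : (inner ℂ (yosida r R x) x).re ≤ 0 := by
  rw [yosida_apply, inner_smul_left, Complex.conj_ofReal, Complex.re_ofReal_mul, inner_sub_left,
    Complex.sub_re]
  have h1 : (inner ℂ ((r : ℂ) • R x) x).re ≤ ‖(r : ℂ) • R x‖ * ‖x‖ :=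
    (Complex.re_le_norm _).trans (norm_inner_le_norm _ _)
  have h2 : (inner ℂ x x).re = ‖x‖ * ‖x‖ := by
    have := inner_self_eq_norm_mul_norm (𝕜 := ℂ) x
    exact this
  have h3 : ‖(r : ℂ) • R x‖ ≤ ‖x‖ := by
    rw [norm_smul, Complex.norm_real, Real.norm_of_nonneg hr.le]
    exact hR.norm_apply_le hA x
  have h4 : ‖(r : ℂ) • R x‖ * ‖x‖ ≤ ‖x‖ * ‖x‖ := by gcongr
  nlinarith

end Resolvent

/-! ### Generation of contraction semigroups -/

section Generation

variable {X : Type*} [NormedAddCommGroup X] [InnerProductSpace ℂ X] {A : X →ₗ.[ℂ] X}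

/-- A vector orthogonal to the domain is of the form `x - A x`, and then `‖x‖² ≤ Re ⟨x - A x, x⟩ =
0`. -/
lemma IsDissipative.dense_domain [CompleteSpace X] (hA : IsDissipative A)
    (hsurj : ∀ y, ∃ x, (x, x - y) ∈ A.graph) : Dense (A.domain : Set X) := by
  rw [Submodule.dense_iff_topologicalClosure_eq_top, Submodule.topologicalClosure_eq_top_iff,
    Submodule.eq_bot_iff]
  intro v hv
  obtain ⟨x, hx⟩ := hsurj v
  have h1 : inner ℂ v x = 0 :=
    Submodule.inner_left_of_mem_orthogonal (LinearPMap.mem_domain_of_mem_graph hx) hv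
  have h2 := hA x _ hx
  rw [inner_sub_left, h1, sub_zero] at h2
  have h3 : ‖x‖ ^ 2 ≤ 0 := by
    rw [← inner_self_eq_norm_sq (𝕜 := ℂ) x]
    exact h2
  have h4 : x = 0 := by
    rw [← norm_eq_zero]
    exact pow_eq_zero_iff (two_ne_zero) |>.1 (le_antisymm h3 (by positivity))
  subst h4
  have := A.graph_fst_eq_zero_snd hx rfl
  simpa using this

lemma IsDissipative.isClosed (hA : IsDissipative A) (hsurj : ∀ y, ∃ x, (x, x - y) ∈ A.graph) :
    A.IsClosed := by
  obtain ⟨R, hR⟩ := hA.exists_isResolvent_one hsurj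
  have e : (A.graph : Set (X × X)) = {p | R (p.1 - p.2) = p.1} := by
    ext ⟨x, y⟩
    constructor
    · intro h
      simpa using hR.apply_sub hA one_pos h
    · intro h
      have h1 := hR (x - y)
      change R (x - y) = x at h
      rw [h, Complex.ofReal_one, one_smul, sub_sub_cancel] at h1
      exact h1
  change _root_.IsClosed (A.graph : Set (X × X))
  rw [e]
  exact isClosed_eq (by fun_prop) (by fun_prop)

lemma IsResolvent.tendsto_yosida (hA : IsDissipative A) (hd : Dense (A.domain : Set X))
    {r : ℕ → ℝ} (hr : ∀ n, 0 < r n) (hr' : Tendsto r atTop atTop) {R : ℕ → X →L[ℂ] X}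
    (hR : ∀ n, IsResolvent A (r n) (R n)) {x y : X} (h : (x, y) ∈ A.graph) :
    Tendsto (fun n => yosida (r n) (R n) x) atTop (𝓝 y) := by
  simp_rw [fun n => (hR n).yosida_eq hA (hr n) h]
  have hcontr : ∀ n z, ‖(r n : ℂ) • R n z‖ ≤ ‖z‖ := fun n z => by
    rw [norm_smul, Complex.norm_real, Real.norm_of_nonneg (hr n).le]
    exact (hR n).norm_apply_le hA z
  have hdom : ∀ {z w : X}, (z, w) ∈ A.graph →
      Tendsto (fun n => (r n : ℂ) • R n z) atTop (𝓝 z) := by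
    intro z w hz
    rw [tendsto_iff_norm_sub_tendsto_zero]
    have hb : ∀ n, ‖(r n : ℂ) • R n z - z‖ ≤ ‖w‖ * (r n)⁻¹ := fun n => by
      have h1 := (hR n).apply_sub hA (hr n) hz
      have h2 : (r n : ℂ) • R n z - z = R n w := by
        nth_rewrite 2 [← h1]
        rw [map_sub, map_smul, sub_sub_cancel]
      rw [h2, ← div_eq_mul_inv, le_div_iff₀' (hr n)]
      exact (hR n).norm_apply_le hA w
    refine squeeze_zero (fun _ => norm_nonneg _) hb ?_
    simpa using (tendsto_inv_atTop_zero.comp hr').const_mul ‖w‖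
  rw [Metric.tendsto_atTop]
  intro ε hε
  obtain ⟨z, hz, hyz⟩ := hd.exists_dist_lt y (show 0 < ε / 3 by positivity)
  obtain ⟨w, hw⟩ := LinearPMap.mem_domain_iff.1 hz
  obtain ⟨N, hN⟩ := Metric.tendsto_atTop.1 (hdom hw) (ε / 3) (by positivity)
  refine ⟨N, fun n hn => ?_⟩
  have h1 := hN n hn
  have h2 : dist ((r n : ℂ) • R n y) ((r n : ℂ) • R n z) ≤ dist y z := by
    rw [dist_eq_norm, dist_eq_norm, ← smul_sub, ← map_sub]
    exact hcontr n _
  calc _ ≤ dist ((r n : ℂ) • R n y) ((r n : ℂ) • R n z) + dist ((r n : ℂ) • R n z) z + dist z y :=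
        dist_triangle4 _ _ _ _
    _ < ε := by rw [dist_comm z y]; linarith

open NormedSpace in
/-- The semigroups generated by commuting bounded dissipative operators `Y n` which converge to
`A` on the dense domain of `A` converge to a contraction semigroup whose generator extends `A`. -/
lemma exists_semigroup_of_tendsto [CompleteSpace X] (hd : Dense (A.domain : Set X))
    {Y : ℕ → X →L[ℂ] X} (hcomm : ∀ m n, Commute (Y m) (Y n))
    (hY : ∀ n x, (inner ℂ (Y n x) x).re ≤ 0)
    (hlim : ∀ x y, (x, y) ∈ A.graph → Tendsto (fun n => Y n x) atTop (𝓝 y)) :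
    ∃ T : ℝ≥0 → X →L[ℂ] X, IsContractionSemigroup T ∧ ∀ x y, (x, y) ∈ A.graph →
      Tendsto (fun t : ℝ≥0 => ((t : ℝ) : ℂ)⁻¹ • (T t x - x)) (𝓝[>] 0) (𝓝 y) := by
  have hcauchy : ∀ (t : ℝ≥0) (x : X), CauchySeq fun n => exp ((t : ℝ) • Y n) x := by
    intro t x
    rw [Metric.cauchySeq_iff]
    intro ε hε
    obtain ⟨z, hz, hxz⟩ := hd.exists_dist_lt x (show 0 < ε / 3 by positivity)
    obtain ⟨w, hw⟩ := LinearPMap.mem_domain_iff.1 hz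
    have hc := ((hlim z w hw).const_smul (t : ℝ)).cauchySeq
    obtain ⟨N, hN⟩ := Metric.cauchySeq_iff.1 hc (ε / 3) (by positivity)
    refine ⟨N, fun m hm n hn => ?_⟩
    have h1 : ∀ k, dist (exp ((t : ℝ) • Y k) x) (exp ((t : ℝ) • Y k) z) ≤ dist x z := fun k => by
      rw [dist_eq_norm, dist_eq_norm, ← map_sub]
      exact norm_exp_smul_apply_le (hY k) t.2 _
    have h2 : dist (exp ((t : ℝ) • Y m) z) (exp ((t : ℝ) • Y n) z) < ε / 3 := by
      refine lt_of_le_of_lt ?_ (hN m hm n hn)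
      rw [dist_eq_norm, dist_eq_norm, ← smul_sub, norm_smul, NNReal.norm_eq]
      exact norm_exp_smul_sub_exp_smul_le (hcomm m n) (hY m) (hY n) t.2 z
    have h3 := h1 n
    rw [dist_comm] at h3
    calc _ ≤ dist (exp ((t : ℝ) • Y m) x) (exp ((t : ℝ) • Y m) z)
          + dist (exp ((t : ℝ) • Y m) z) (exp ((t : ℝ) • Y n) z)
          + dist (exp ((t : ℝ) • Y n) z) (exp ((t : ℝ) • Y n) x) := dist_triangle4 _ _ _ _
      _ < ε := by linarith [h1 m]
  choose f hf using fun t x => cauchySeq_tendsto_of_complete (hcauchy t x)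
  let T : ℝ≥0 → X →L[ℂ] X := fun t =>
    continuousLinearMapOfTendsto (fun n => exp ((t : ℝ) • Y n)) (tendsto_pi_nhds.2 (hf t))
  have hT : ∀ (t : ℝ≥0) (x : X), Tendsto (fun n => exp ((t : ℝ) • Y n) x) atTop (𝓝 (T t x)) := hf
  have hcontr : ∀ t x, ‖T t x‖ ≤ ‖x‖ := fun t x =>
    le_of_tendsto (hT t x).norm (Eventually.of_forall fun n => norm_exp_smul_apply_le (hY n) t.2 x)
  let _ : NormedAlgebra ℚ (X →L[ℂ] X) := NormedAlgebra.restrictScalars ℚ ℂ (X →L[ℂ] X)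
  have hadd : ∀ s t x, T (s + t) x = T s (T t x) := by
    intro s t x
    refine tendsto_nhds_unique (hT (s + t) x) ?_
    have e : ∀ n, exp (((s + t : ℝ≥0) : ℝ) • Y n) x
        = exp ((s : ℝ) • Y n) (exp ((t : ℝ) • Y n) x - T t x) + exp ((s : ℝ) • Y n) (T t x) := fun n => by
      rw [← map_add, sub_add_cancel, NNReal.coe_add, add_smul,
        exp_add_of_commute (((Commute.refl (Y n)).smul_left (s : ℝ)).smul_right (t : ℝ))]
      rfl
    simp_rw [e]
    rw [← zero_add (T s (T t x))]
    refine Tendsto.add ?_ (hT s _)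
    have h0 := tendsto_iff_norm_sub_tendsto_zero.1 (hT t x)
    exact squeeze_zero_norm (fun n => norm_exp_smul_apply_le (hY n) s.2 _) h0
  have hsub : ∀ t : ℝ≥0, ∀ x y : X, (x, y) ∈ A.graph → ‖T t x - x‖ ≤ t * ‖y‖ := fun t x y h =>
    le_of_tendsto_of_tendsto' ((hT t x).sub_const x).norm ((hlim x y h).norm.const_mul (t : ℝ))
      fun n => norm_exp_smul_sub_self_le (hY n) t.2 x
  have hcont : ∀ x y, (x, y) ∈ A.graph → Continuous fun t => T t x := by
    intro x y h
    refine (LipschitzWith.of_dist_le_mul (K := ‖y‖₊) ?_).continuous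
    have key : ∀ s t : ℝ≥0, s ≤ t → dist (T s x) (T t x) ≤ ‖y‖₊ * dist s t := by
      intro s t hst
      obtain ⟨d, rfl⟩ := exists_add_of_le hst
      rw [hadd, dist_comm, dist_eq_norm, ← map_sub]
      refine (hcontr s _).trans ((hsub d x y h).trans_eq ?_)
      rw [NNReal.dist_eq]
      simp [mul_comm]
    intro s t
    rcases le_total s t with hst | hst
    · exact key s t hst
    · rw [dist_comm, dist_comm s t]
      exact key t s hst
  refine ⟨T, ⟨?_, ?_, ?_, ?_⟩, ?_⟩
  · ext x
    refine tendsto_nhds_unique (hT 0 x) ?_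
    simp
  · intro s t
    ext x
    exact hadd s t x
  · intro x
    refine continuous_of_uniform_approx_of_continuous fun u hu => ?_
    obtain ⟨ε, hε, hu⟩ := Metric.mem_uniformity_dist.1 hu
    obtain ⟨z, hz, hxz⟩ := hd.exists_dist_lt x hε
    obtain ⟨w, hw⟩ := LinearPMap.mem_domain_iff.1 hz
    refine ⟨fun t => T t z, hcont z w hw, fun t => hu ?_⟩
    rw [dist_eq_norm, ← map_sub]
    exact (hcontr t _).trans_lt (by rwa [← dist_eq_norm])
  · exact fun t => (T t).opNorm_le_bound zero_le_one fun x => by simpa using hcontr t x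
  · intro x y h
    rw [Metric.tendsto_nhdsWithin_nhds]
    intro ε hε
    -- `y` itself need not lie in the domain of `A`; a nearby vector of the domain does.
    obtain ⟨z, hz, hyz⟩ := hd.exists_dist_lt y (show 0 < ε / 4 by positivity)
    obtain ⟨w, hw⟩ := LinearPMap.mem_domain_iff.1 hz
    rw [dist_eq_norm] at hyz
    refine ⟨ε / 4 / (‖w‖ + 1), by positivity, fun t ht ht' => ?_⟩
    have htpos : (0 : ℝ) < t := ht
    have htw : t * ‖w‖ < ε / 4 := by
      rw [NNReal.dist_eq, NNReal.coe_zero, sub_zero, abs_of_pos htpos,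
        lt_div_iff₀ (by positivity)] at ht'
      linarith
    have h1 : ‖T t x - x - (t : ℝ) • z‖ ≤ (t * ‖w‖ + ‖y - z‖) * t :=
      le_of_tendsto_of_tendsto' (((hT t x).sub_const x).sub_const _).norm
        ((((hlim z w hw).norm.const_mul (t : ℝ)).add ((hlim x y h).sub_const z).norm).mul_const _)
        fun n => norm_exp_smul_sub_taylor_le (hY n) t.2 x z
    have h2 : ((t : ℝ) : ℂ)⁻¹ • (T t x - x) - y
        = ((t : ℝ) : ℂ)⁻¹ • (T t x - x - (t : ℝ) • z) - (y - z) := by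
      have : ((t : ℝ) : ℂ)⁻¹ • (t : ℝ) • z = z := by
        rw [← Complex.coe_smul, smul_smul, inv_mul_cancel₀ (Complex.ofReal_ne_zero.2 htpos.ne'),
          one_smul]
      rw [smul_sub _ (T t x - x), this]
      abel
    have h3 : ‖((t : ℝ) : ℂ)⁻¹ • (T t x - x - (t : ℝ) • z)‖ ≤ t * ‖w‖ + ‖y - z‖ := by
      rw [norm_smul, norm_inv, Complex.norm_real, Real.norm_of_nonneg htpos.le, inv_mul_eq_div,
        div_le_iff₀ htpos]
      exact h1
    rw [dist_eq_norm, h2]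
    exact (norm_sub_le _ _).trans_lt (by linarith)

/-- A vector `d` which a contraction semigroup carries along itself, `T t d = d + t d + o(t)`, is
zero, because `‖d + t d‖` exceeds `‖d‖` by `t ‖d‖`. -/
lemma IsContractionSemigroup.eq_zero_of_tendsto_self {T : ℝ≥0 → X →L[ℂ] X}
    (hT : IsContractionSemigroup T) {d : X}
    (h : Tendsto (fun t : ℝ≥0 => ((t : ℝ) : ℂ)⁻¹ • (T t d - d)) (𝓝[>] 0) (𝓝 d)) : d = 0 := by
  have hle : ∀ t : ℝ≥0, ‖T t d‖ ≤ ‖d‖ := fun t => by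
    simpa using (T t).le_of_opNorm_le (hT.contraction t) d
  have h1 : Tendsto (fun t : ℝ≥0 => (inner ℂ (((t : ℝ) : ℂ)⁻¹ • (T t d - d)) d).re) (𝓝[>] 0)
      (𝓝 (inner ℂ d d).re) :=
    (Complex.continuous_re.tendsto _).comp (h.inner tendsto_const_nhds)
  have h2 : (inner ℂ d d).re ≤ 0 := by
    refine le_of_tendsto h1 (Eventually.of_forall fun t => ?_)
    rw [inner_smul_left, map_inv₀, Complex.conj_ofReal, ← Complex.ofReal_inv,
      Complex.re_ofReal_mul, inner_sub_left, Complex.sub_re]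
    have h3 : (inner ℂ (T t d) d).re ≤ ‖T t d‖ * ‖d‖ :=
      (Complex.re_le_norm _).trans (norm_inner_le_norm _ _)
    have h4 : (inner ℂ d d).re = ‖d‖ * ‖d‖ := inner_self_eq_norm_mul_norm (𝕜 := ℂ) d
    have h5 : ‖T t d‖ * ‖d‖ ≤ ‖d‖ * ‖d‖ := by
      gcongr
      exact hle t
    exact mul_nonpos_of_nonneg_of_nonpos (by positivity) (by linarith)
  have h4 : (inner ℂ d d).re = ‖d‖ * ‖d‖ := inner_self_eq_norm_mul_norm (𝕜 := ℂ) d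
  have h5 : ‖d‖ * ‖d‖ = 0 := le_antisymm (by linarith) (by positivity)
  simpa using h5

/-- The Lumer–Phillips theorem in a Hilbert space: a dissipative operator `A` for which `1 - A` is
onto generates a contraction semigroup. -/
theorem IsDissipative.exists_isGenerator [CompleteSpace X] (hA : IsDissipative A)
    (hsurj : ∀ y, ∃ x, (x, x - y) ∈ A.graph) :
    ∃ T : ℝ≥0 → X →L[ℂ] X, IsContractionSemigroup T ∧ IsGenerator A T := by
  have hd := hA.dense_domain hsurj
  choose R hR using hA.exists_isResolvent hsurj
  have hr : ∀ n : ℕ, (0 : ℝ) < 1 + n / 2 := fun n => by positivity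
  have hr' : Tendsto (fun n : ℕ => (1 + n / 2 : ℝ)) atTop atTop :=
    tendsto_atTop_add_const_left _ _ (tendsto_natCast_atTop_atTop.atTop_div_const two_pos)
  obtain ⟨T, hT, hgen⟩ := exists_semigroup_of_tendsto hd
    (fun m n => commute_yosida ((hR m).commute hA (hr m) (hr n) (hR n)) _ _)
    (fun n => (hR n).yosida_dissipative hA (hr n))
    (fun x y h => IsResolvent.tendsto_yosida hA hd hr hr' hR h)
  refine ⟨T, hT, fun x y => ⟨hgen x y, fun h => ?_⟩⟩
  -- The generator of `T` extends `A`; since `1 - A` is onto, it has no room to be larger.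
  obtain ⟨z, hz⟩ := hsurj (x - y)
  have h1 := h.sub (hgen _ _ hz)
  have h2 : x - z = 0 := by
    refine hT.eq_zero_of_tendsto_self ?_
    convert h1 using 2 with t
    · rw [← smul_sub, map_sub]
      congr 1
      abel
    · abel
  obtain rfl := sub_eq_zero.1 h2
  simpa using hz

end Generation

/-! ### Absolutely continuous functions on an interval -/

open ComplexConjugate

/-- `F` is absolutely continuous on `[c, d]` with almost everywhere derivative `w`, expressed by the
fundamental theorem of calculus. -/
structure IsPrimitive (F w : ℝ → ℂ) (c d : ℝ) : Prop where
  intervalIntegrable : IntervalIntegrable w volume c d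
  eq_add_integral : ∀ x ∈ Icc c d, F x = F c + ∫ t in c..x, w t

/-- Integration by parts for primitives vanishing at `c`: by Fubini, the two summands are the
integrals of `w x * v y` over the two triangles into which the diagonal divides the square `(c,
d]²`. -/
lemma integral_mul_primitive_add {w v : ℝ → ℂ} {c d : ℝ} (hcd : c ≤ d)
    (hw : IntervalIntegrable w volume c d) (hv : IntervalIntegrable v volume c d) :
    (∫ x in c..d, w x * ∫ t in c..x, v t) + (∫ x in c..d, (∫ t in c..x, w t) * v x)
      = (∫ x in c..d, w x) * ∫ x in c..d, v x := by
  rw [intervalIntegrable_iff_integrableOn_Ioc_of_le hcd] at hw hv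
  set μ := (volume : Measure ℝ).restrict (Ioc c d) with hμ
  set h : ℝ × ℝ → ℂ := fun z => w z.1 * v z.2 with hh
  have hi : Integrable h (μ.prod μ) := Integrable.mul_prod hw hv
  have hS : MeasurableSet {z : ℝ × ℝ | z.2 ≤ z.1} :=
    measurableSet_le measurable_snd measurable_fst
  have h1 : ∫ z in {z : ℝ × ℝ | z.2 ≤ z.1}, h z ∂μ.prod μ
      = ∫ x in c..d, w x * ∫ t in c..x, v t := by
    rw [← integral_indicator hS, integral_prod _ (hi.indicator hS),
      intervalIntegral.integral_of_le hcd]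
    refine setIntegral_congr_fun measurableSet_Ioc fun x hx => ?_
    have e : ∀ y, {z : ℝ × ℝ | z.2 ≤ z.1}.indicator h (x, y) = w x * (Iic x).indicator v y :=
      fun y => by
        by_cases hy : y ≤ x
        · rw [indicator_of_mem (by exact hy), indicator_of_mem (by exact hy)]
        · rw [indicator_of_notMem (by exact hy), indicator_of_notMem (by exact hy), mul_zero]
    simp_rw [e]
    rw [integral_const_mul, integral_indicator measurableSet_Iic, hμ,
      Measure.restrict_restrict measurableSet_Iic, intervalIntegral.integral_of_le hx.1.le]
    have hs : Iic x ∩ Ioc c d = Ioc c x := by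
      ext y
      exact ⟨fun h => ⟨h.2.1, h.1⟩, fun h => ⟨h.2, h.1, h.2.trans hx.2⟩⟩
    rw [hs]
  have h2 : ∫ z in {z : ℝ × ℝ | z.2 ≤ z.1}ᶜ, h z ∂μ.prod μ
      = ∫ x in c..d, (∫ t in c..x, w t) * v x := by
    rw [← integral_indicator hS.compl, integral_prod_symm _ (hi.indicator hS.compl),
      intervalIntegral.integral_of_le hcd]
    refine setIntegral_congr_fun measurableSet_Ioc fun y hy => ?_
    have e : ∀ x, {z : ℝ × ℝ | z.2 ≤ z.1}ᶜ.indicator h (x, y) = (Iio y).indicator w x * v y :=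
      fun x => by
        by_cases hx : x < y
        · rw [indicator_of_mem (by exact not_le.2 hx), indicator_of_mem (by exact hx)]
        · rw [indicator_of_notMem (by exact fun h => h (not_lt.1 hx)),
            indicator_of_notMem (by exact hx), zero_mul]
    simp_rw [e]
    rw [integral_mul_const, integral_indicator measurableSet_Iio, hμ,
      Measure.restrict_restrict measurableSet_Iio, intervalIntegral.integral_of_le hy.1.le,
      integral_Ioc_eq_integral_Ioo]
    have hs : Iio y ∩ Ioc c d = Ioo c y := by
      ext x
      exact ⟨fun h => ⟨h.2.1, h.1⟩, fun h => ⟨h.2, h.1, h.2.le.trans hy.2⟩⟩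
    rw [hs]
  rw [← h1, ← h2, integral_add_compl hS hi, integral_prod_mul,
    intervalIntegral.integral_of_le hcd, intervalIntegral.integral_of_le hcd]

namespace IsPrimitive

variable {F G w v : ℝ → ℂ} {c d : ℝ}

lemma continuousOn (h : IsPrimitive F w c d) (hcd : c ≤ d) : ContinuousOn F (Icc c d) := by
  have h1 : ContinuousOn (fun x => F c + ∫ t in c..x, w t) (Icc c d) := by
    refine continuousOn_const.add ?_
    have := intervalIntegral.continuousOn_primitive_interval (a := c) (b := d) (f := w)
      (μ := volume) (by
        rw [uIcc_of_le hcd, integrableOn_Icc_iff_integrableOn_Ioc]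
        exact (intervalIntegrable_iff_integrableOn_Ioc_of_le hcd).1 h.intervalIntegrable)
    rwa [uIcc_of_le hcd] at this
  exact h1.congr h.eq_add_integral

lemma star (h : IsPrimitive F w c d) :
    IsPrimitive (fun x => conj (F x)) (fun x => conj (w x)) c d := by
  let L : ℂ →L[ℝ] ℂ := Complex.conjCLE
  refine ⟨⟨L.integrable_comp h.intervalIntegrable.1, L.integrable_comp h.intervalIntegrable.2⟩, ?_⟩
  intro x hx
  have hi : IntervalIntegrable w volume c x := h.intervalIntegrable.mono_set (by
    rw [uIcc_of_le hx.1, uIcc_of_le (hx.1.trans hx.2)]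
    exact Icc_subset_Icc_right hx.2)
  have := L.intervalIntegral_comp_comm hi
  rw [h.eq_add_integral x hx, map_add]
  congr 1
  exact this.symm

lemma ofReal {φ : ℝ → ℝ} (hφ : ContDiff ℝ ∞ φ) :
    IsPrimitive (fun x => (φ x : ℂ)) (fun x => ((deriv φ x : ℝ) : ℂ)) c d := by
  have hc : Continuous (deriv φ) := hφ.continuous_deriv (by simp)
  refine ⟨(Complex.continuous_ofReal.comp hc).intervalIntegrable _ _, fun x _ => ?_⟩
  rw [intervalIntegral.integral_ofReal, intervalIntegral.integral_deriv_eq_sub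
    (fun y _ => (hφ.differentiable (by simp)).differentiableAt) (hc.intervalIntegrable _ _)]
  push_cast
  ring

/-- Integration by parts. -/
lemma integral_mul_add_mul (hF : IsPrimitive F w c d) (hG : IsPrimitive G v c d) (hcd : c ≤ d) :
    ∫ x in c..d, (w x * G x + F x * v x) = F d * G d - F c * G c := by
  have hFi := hF.intervalIntegrable
  have hGi := hG.intervalIntegrable
  have hFc := hF.continuousOn hcd
  have hGc := hG.continuousOn hcd
  rw [← uIcc_of_le hcd] at hFc hGc
  rw [intervalIntegral.integral_add (hFi.mul_continuousOn hGc) (hGi.continuousOn_mul hFc)]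
  have e1 : ∫ x in c..d, w x * G x
      = G c * (∫ x in c..d, w x) + ∫ x in c..d, w x * ∫ t in c..x, v t := by
    rw [← intervalIntegral.integral_const_mul, ← intervalIntegral.integral_add (hFi.const_mul _)]
    · refine intervalIntegral.integral_congr fun x hx => ?_
      rw [uIcc_of_le hcd] at hx
      simp only [hG.eq_add_integral x hx]
      ring
    · have h1 : ContinuousOn (fun x => G x - G c) (uIcc c d) := hGc.sub continuousOn_const
      refine hFi.mul_continuousOn (h1.congr fun x hx => ?_)
      rw [uIcc_of_le hcd] at hx
      simp only [hG.eq_add_integral x hx]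
      ring
  have e2 : ∫ x in c..d, F x * v x
      = F c * (∫ x in c..d, v x) + ∫ x in c..d, (∫ t in c..x, w t) * v x := by
    rw [← intervalIntegral.integral_const_mul, ← intervalIntegral.integral_add (hGi.const_mul _)]
    · refine intervalIntegral.integral_congr fun x hx => ?_
      rw [uIcc_of_le hcd] at hx
      simp only [hF.eq_add_integral x hx]
      ring
    · have h1 : ContinuousOn (fun x => F x - F c) (uIcc c d) := hFc.sub continuousOn_const
      refine hGi.continuousOn_mul (h1.congr fun x hx => ?_)
      rw [uIcc_of_le hcd] at hx
      simp only [hF.eq_add_integral x hx]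
      ring
  rw [e1, e2, hF.eq_add_integral d (right_mem_Icc.2 hcd),
    hG.eq_add_integral d (right_mem_Icc.2 hcd)]
  linear_combination integral_mul_primitive_add hcd hFi hGi

end IsPrimitive

/-! ### Weak derivatives on an interval and boundary values -/

lemma memLp_two_of_continuousOn {F : ℝ → ℂ} {c d : ℝ} (hF : ContinuousOn F (Icc c d))
    {s : Set ℝ} (hs : MeasurableSet s) (hsub : s ⊆ Icc c d) :
    MemLp F 2 (volume.restrict s) := by
  obtain ⟨C, hC⟩ := isCompact_Icc.exists_bound_of_continuousOn hF
  have : IsFiniteMeasure (volume.restrict s) :=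
    ⟨by
      rw [Measure.restrict_apply_univ]
      exact (measure_mono hsub).trans_lt measure_Icc_lt_top⟩
  refine MemLp.of_bound ((hF.mono hsub).aestronglyMeasurable hs) C ?_
  exact (ae_restrict_iff' hs).2 (Eventually.of_forall fun x hx => hC x (hsub hx))

lemma IsTest.mono {Ω Ω' : TopologicalSpace.Opens ℝ} {φ : ℝ → ℝ} (h : IsTest Ω φ)
    (hsub : (Ω : Set ℝ) ⊆ Ω') : IsTest Ω' φ :=
  ⟨h.smooth, h.compact, h.supp.trans hsub⟩

lemma IsTest.eq_zero {Ω : TopologicalSpace.Opens ℝ} {φ : ℝ → ℝ} (h : IsTest Ω φ) {x : ℝ}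
    (hx : x ∉ Ω) : φ x = 0 :=
  image_eq_zero_of_notMem_tsupport fun hx' => hx (h.supp hx')

lemma IsTest.deriv_eq_zero {Ω : TopologicalSpace.Opens ℝ} {φ : ℝ → ℝ} (h : IsTest Ω φ) {x : ℝ}
    (hx : x ∉ Ω) : deriv φ x = 0 :=
  image_eq_zero_of_notMem_tsupport fun hx' => hx (h.supp (tsupport_deriv_subset hx'))

lemma HasWeakDeriv.of_smul {Ω : TopologicalSpace.Opens ℝ} {f g : L2 Ω} {c : ℂ}
    (hc : c ≠ 0) (h : HasWeakDeriv Ω (c • f) g) : HasWeakDeriv Ω f (c⁻¹ • g) := by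
  have := h.smul c⁻¹
  rwa [inv_smul_smul₀ hc] at this

/-- Absolutely continuous functions are weakly differentiable. -/
lemma IsPrimitive.hasWeakDeriv {F w : ℝ → ℂ} {c d : ℝ} (h : IsPrimitive F w c d) (hcd : c ≤ d)
    {Ω : TopologicalSpace.Opens ℝ} (hΩ : (Ω : Set ℝ) ⊆ Ioo c d) {f g : L2 Ω}
    (hf : f =ᵐ[volume.restrict (Ω : Set ℝ)] F) (hg : g =ᵐ[volume.restrict (Ω : Set ℝ)] w) :
    HasWeakDeriv Ω f g := by
  intro φ hφ
  have hc : φ c = 0 := hφ.eq_zero fun hx => (hΩ hx).1.false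
  have hd : φ d = 0 := hφ.eq_zero fun hx => (hΩ hx).2.false
  have h1 := (IsPrimitive.ofReal (c := c) (d := d) hφ.smooth).integral_mul_add_mul h hcd
  rw [hc, hd, Complex.ofReal_zero, zero_mul, zero_mul, sub_zero,
    intervalIntegral.integral_of_le hcd, integral_Ioc_eq_integral_Ioo,
    setIntegral_eq_of_subset_of_forall_sdiff_eq_zero measurableSet_Ioo hΩ (fun x hx => by
      rw [hφ.eq_zero hx.2, hφ.deriv_eq_zero hx.2]; simp)] at h1
  have h2 : ∫ x in (Ω : Set ℝ), (deriv φ x • f x + φ x • g x) = 0 := by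
    rw [← h1]
    refine integral_congr_ae ?_
    filter_upwards [hf, hg] with x hx hx'
    rw [hx, hx', Complex.real_smul, Complex.real_smul]
  rw [integral_add (hφ.integrable_deriv f) (hφ.integrable g)] at h2
  exact eq_neg_of_add_eq_zero_left h2

lemma L2.intervalIntegrable {Ω : TopologicalSpace.Opens ℝ} (g : L2 Ω) {c d : ℝ} (hcd : c ≤ d)
    (hΩ : Ioo c d ⊆ (Ω : Set ℝ)) : IntervalIntegrable g volume c d := by
  rw [intervalIntegrable_iff_integrableOn_Ioo_of_le hcd]
  exact ((Lp.memLp g).mono_measure (Measure.restrict_mono hΩ le_rfl)).integrable (by norm_num)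

lemma L2.integrableOn {Ω : TopologicalSpace.Opens ℝ} (hΩ : volume (Ω : Set ℝ) ≠ ⊤) (g : L2 Ω) :
    IntegrableOn g (Ω : Set ℝ) :=
  have : IsFiniteMeasure (volume.restrict (Ω : Set ℝ)) := isFiniteMeasure_restrict.2 hΩ
  (Lp.memLp g).integrable (by norm_num)

/-- A weakly differentiable function has an absolutely continuous representative on every bounded
subinterval of `Ω`. -/
lemma HasWeakDeriv.exists_isPrimitive {Ω : TopologicalSpace.Opens ℝ} {f g : L2 Ω}
    (h : HasWeakDeriv Ω f g) {c d : ℝ} (hcd : c < d) (hΩ : Ioo c d ⊆ (Ω : Set ℝ)) :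
    ∃ F, IsPrimitive F g c d ∧ f =ᵐ[volume.restrict (Ioo c d)] F := by
  let I : TopologicalSpace.Opens ℝ := ⟨Ioo c d, isOpen_Ioo⟩
  have hres : ∀ k : L2 Ω, MemLp k 2 (volume.restrict (I : Set ℝ)) := fun k =>
    (Lp.memLp k).mono_measure (Measure.restrict_mono hΩ le_rfl)
  have hgi := L2.intervalIntegrable g hcd.le hΩ
  have hG : IsPrimitive (fun x => ∫ t in c..x, g t) g c d := ⟨hgi, fun x _ => by simp⟩
  have hG2 := memLp_two_of_continuousOn (hG.continuousOn hcd.le) measurableSet_Ioo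
    Ioo_subset_Icc_self
  -- the restriction of the weak derivative to the subinterval
  have h1 : HasWeakDeriv I ((hres f).toLp f) ((hres g).toLp g) := by
    intro φ hφ
    have e : ∀ (ψ : ℝ → ℝ) (k : L2 Ω), (∀ x, x ∉ Ioo c d → ψ x = 0) →
        ∫ x in (I : Set ℝ), ψ x • (hres k).toLp k x = ∫ x in (Ω : Set ℝ), ψ x • k x := by
      intro ψ k hψ
      rw [setIntegral_eq_of_subset_of_forall_sdiff_eq_zero (s := (I : Set ℝ))
        Ω.isOpen.measurableSet hΩ
        (fun x hx => by rw [hψ x hx.2, zero_smul])]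
      refine integral_congr_ae ?_
      filter_upwards [(hres k).coeFn_toLp] with x hx
      rw [hx]
    rw [e _ f fun x hx => hφ.deriv_eq_zero hx, e _ g fun x hx => hφ.eq_zero hx]
    exact h φ (hφ.mono hΩ)
  have h2 : HasWeakDeriv I (hG2.toLp _) ((hres g).toLp g) :=
    hG.hasWeakDeriv hcd.le subset_rfl hG2.coeFn_toLp (hres g).coeFn_toLp
  have h3 := h1.add (h2.smul (-1))
  rw [neg_one_smul, neg_one_smul, add_neg_cancel] at h3
  obtain ⟨C, hC⟩ := h3.ae_const hcd subset_rfl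
  refine ⟨fun x => C + ∫ t in c..x, g t, ⟨hgi, fun x _ => by simp⟩, ?_⟩
  have h4 := Lp.coeFn_add ((hres f).toLp f) (-(hG2.toLp _))
  have h5 := Lp.coeFn_neg (hG2.toLp (fun x => ∫ t in c..x, g t))
  filter_upwards [hC, h4, h5, (hres f).coeFn_toLp, hG2.coeFn_toLp] with x h6 h7 h8 h9 h10
  rw [h7, Pi.add_apply, h8, Pi.neg_apply, h9, h10] at h6
  rw [← h6]
  ring

lemma Icc_subset_closure {Ω : Set ℝ} {c d : ℝ} (hcd : c < d) (hΩ : Ioo c d ⊆ Ω) :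
    Icc c d ⊆ closure Ω := by
  rw [← closure_Ioo hcd.ne]
  exact closure_mono hΩ

lemma HasTrace.eq_of_continuousOn {Ω : TopologicalSpace.Opens ℝ} {f : L2 Ω} {c d x : ℝ} {z : ℂ}
    (h : HasTrace f x z) (hcd : c < d) (hΩ : Ioo c d ⊆ (Ω : Set ℝ)) {F : ℝ → ℂ}
    (hF : ContinuousOn F (Icc c d)) (hf : f =ᵐ[volume.restrict (Ioo c d)] F) (hx : x ∈ Icc c d) :
    F x = z := by
  obtain ⟨g, hg, hfg, rfl⟩ := h
  have h1 : f =ᵐ[volume.restrict (Ioo c d)] g := ae_restrict_of_ae_restrict_of_subset hΩ hfg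
  have h2 : F =ᵐ[volume.restrict (Icc c d)] g := by
    rw [← restrict_Ioo_eq_restrict_Icc]
    exact hf.symm.trans h1
  exact Measure.eqOn_Icc_of_ae_eq volume hcd.ne h2 hF (hg.mono (Icc_subset_closure hcd hΩ)) hx

/-- Integration by parts with boundary values. -/
lemma HasWeakDeriv.integral_conj_mul_add {Ω : TopologicalSpace.Opens ℝ} {f f' g g' : L2 Ω}
    (hf : HasWeakDeriv Ω f f') (hg : HasWeakDeriv Ω g g') {c d : ℝ} (hcd : c < d)
    (hΩ : Ioo c d ⊆ (Ω : Set ℝ)) {fc fd gc gd : ℂ} (hfc : HasTrace f c fc) (hfd : HasTrace f d fd)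
    (hgc : HasTrace g c gc) (hgd : HasTrace g d gd) :
    ∫ x in Ioo c d, (conj (f' x) * g x + conj (f x) * g' x) = conj fd * gd - conj fc * gc := by
  obtain ⟨F, hF, hfF⟩ := hf.exists_isPrimitive hcd hΩ
  obtain ⟨G, hG, hgG⟩ := hg.exists_isPrimitive hcd hΩ
  have hFc := hF.continuousOn hcd.le
  have hGc := hG.continuousOn hcd.le
  rw [← hfc.eq_of_continuousOn hcd hΩ hFc hfF (left_mem_Icc.2 hcd.le),
    ← hfd.eq_of_continuousOn hcd hΩ hFc hfF (right_mem_Icc.2 hcd.le),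
    ← hgc.eq_of_continuousOn hcd hΩ hGc hgG (left_mem_Icc.2 hcd.le),
    ← hgd.eq_of_continuousOn hcd hΩ hGc hgG (right_mem_Icc.2 hcd.le),
    ← hF.star.integral_mul_add_mul hG hcd.le, intervalIntegral.integral_of_le hcd.le,
    integral_Ioc_eq_integral_Ioo]
  refine integral_congr_ae ?_
  filter_upwards [hfF, hgG] with x h1 h2
  rw [h1, h2]

/-- Integration by parts against a smooth function. -/
lemma HasWeakDeriv.integral_smul_add {Ω : TopologicalSpace.Opens ℝ} {f f' : L2 Ω}
    (hf : HasWeakDeriv Ω f f') {c d : ℝ} (hcd : c < d) (hΩ : Ioo c d ⊆ (Ω : Set ℝ)) {fc fd : ℂ}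
    (hfc : HasTrace f c fc) (hfd : HasTrace f d fd) {φ : ℝ → ℝ} (hφ : ContDiff ℝ ∞ φ) :
    ∫ x in Ioo c d, (deriv φ x • f x + φ x • f' x) = φ d * fd - φ c * fc := by
  obtain ⟨F, hF, hfF⟩ := hf.exists_isPrimitive hcd hΩ
  have hFc := hF.continuousOn hcd.le
  rw [← hfc.eq_of_continuousOn hcd hΩ hFc hfF (left_mem_Icc.2 hcd.le),
    ← hfd.eq_of_continuousOn hcd hΩ hFc hfF (right_mem_Icc.2 hcd.le),
    ← (IsPrimitive.ofReal hφ).integral_mul_add_mul hF hcd.le,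
    intervalIntegral.integral_of_le hcd.le, integral_Ioc_eq_integral_Ioo]
  refine integral_congr_ae ?_
  filter_upwards [hfF] with x h1
  rw [h1, Complex.real_smul, Complex.real_smul]

lemma HasWeakDeriv.integral_eq_sub {Ω : TopologicalSpace.Opens ℝ} {f f' : L2 Ω}
    (hf : HasWeakDeriv Ω f f') {c d : ℝ} (hcd : c < d) (hΩ : Ioo c d ⊆ (Ω : Set ℝ)) {fc fd : ℂ}
    (hfc : HasTrace f c fc) (hfd : HasTrace f d fd) : ∫ x in Ioo c d, f' x = fd - fc := by
  simpa using hf.integral_smul_add hcd hΩ hfc hfd (φ := fun _ => 1) contDiff_const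

lemma HasTrace.of_continuousOn {Ω : TopologicalSpace.Opens ℝ} {f : L2 Ω} {F : ℝ → ℂ}
    (hF : ContinuousOn F (closure (Ω : Set ℝ))) (hf : f =ᵐ[volume.restrict (Ω : Set ℝ)] F)
    (x : ℝ) : HasTrace f x (F x) :=
  ⟨F, hF, hf, rfl⟩

/-! ### Smooth functions as elements of `L²` -/

lemma memLp_ofReal {ψ : ℝ → ℝ} (hc : Continuous ψ) (hs : HasCompactSupport ψ)
    (Ω : TopologicalSpace.Opens ℝ) :
    MemLp (fun x => (ψ x : ℂ)) 2 (volume.restrict (Ω : Set ℝ)) :=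
  ((hc.memLp_of_hasCompactSupport (μ := volume) hs).restrict _).ofReal

lemma inner_toLp_ofReal {Ω : TopologicalSpace.Opens ℝ} {ψ : ℝ → ℝ}
    (h : MemLp (fun x => (ψ x : ℂ)) 2 (volume.restrict (Ω : Set ℝ))) (f : L2 Ω) :
    inner ℂ (h.toLp _) f = ∫ x in (Ω : Set ℝ), ψ x • f x := by
  rw [MeasureTheory.L2.inner_def]
  refine integral_congr_ae ?_
  filter_upwards [h.coeFn_toLp] with x hx
  rw [hx, RCLike.inner_apply, Complex.conj_ofReal, Complex.real_smul, mul_comm]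

lemma continuous_integral_smul {Ω : TopologicalSpace.Opens ℝ} {ψ : ℝ → ℝ} (hc : Continuous ψ)
    (hs : HasCompactSupport ψ) : Continuous fun f : L2 Ω => ∫ x in (Ω : Set ℝ), ψ x • f x := by
  simp_rw [← inner_toLp_ofReal (memLp_ofReal hc hs Ω)]
  fun_prop

/-- The weak derivative of a smooth function is its derivative. -/
lemma hasWeakDeriv_toLp {Ω : TopologicalSpace.Opens ℝ} {c d : ℝ} (hcd : c ≤ d)
    (hΩ : (Ω : Set ℝ) ⊆ Ioo c d) {φ : ℝ → ℝ} (hφ : ContDiff ℝ ∞ φ)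
    (h : MemLp (fun x => (φ x : ℂ)) 2 (volume.restrict (Ω : Set ℝ)))
    (h' : MemLp (fun x => ((deriv φ x : ℝ) : ℂ)) 2 (volume.restrict (Ω : Set ℝ))) :
    HasWeakDeriv Ω (h.toLp _) (h'.toLp _) :=
  (IsPrimitive.ofReal hφ).hasWeakDeriv hcd hΩ h.coeFn_toLp h'.coeFn_toLp

lemma hasTrace_toLp {Ω : TopologicalSpace.Opens ℝ} {φ : ℝ → ℝ} (hφ : Continuous φ)
    (h : MemLp (fun x => (φ x : ℂ)) 2 (volume.restrict (Ω : Set ℝ))) (x : ℝ) :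
    HasTrace (h.toLp _) x (φ x) :=
  HasTrace.of_continuousOn (F := fun x => (φ x : ℂ))
    (Complex.continuous_ofReal.comp hφ).continuousOn h.coeFn_toLp x

namespace Bar

open ComplexConjugate

/-! ### Piecewise functions on the bar -/

variable {P : Bar}

lemma L₁_lt_L₃ (P : Bar) : P.L₁ < P.L₃ := P.L₁_lt_L₂.trans P.L₂_lt_L₃

lemma L₂_pos (P : Bar) : 0 < P.L₂ := P.L₁_pos.trans P.L₁_lt_L₂

lemma L₃_pos (P : Bar) : 0 < P.L₃ := P.L₂_pos.trans P.L₂_lt_L₃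

/-- The whole bar `(0, L₃)`. -/
def whole (P : Bar) : TopologicalSpace.Opens ℝ := ⟨Ioo 0 P.L₃, isOpen_Ioo⟩

lemma mid_subset_whole : (P.mid : Set ℝ) ⊆ P.whole := fun _ hx =>
  ⟨P.L₁_pos.trans hx.1, hx.2.trans P.L₂_lt_L₃⟩

lemma outer_subset_whole : (P.outer : Set ℝ) ⊆ P.whole := by
  rintro x (hx | hx)
  · exact ⟨hx.1, hx.2.trans P.L₁_lt_L₃⟩
  · exact ⟨P.L₂_pos.trans hx.1, hx.2⟩

lemma disjoint_outer_pieces : Disjoint (Ioo 0 P.L₁) (Ioo P.L₂ P.L₃) :=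
  Set.disjoint_left.2 fun _ h h' => (h.2.trans (P.L₁_lt_L₂.trans h'.1)).false

lemma disjoint_mid_outer : Disjoint (P.mid : Set ℝ) P.outer := by
  refine Set.disjoint_left.2 fun x h => ?_
  rintro (h' | h')
  · exact (h.1.trans h'.2).false
  · exact (h.2.trans h'.1).false

lemma integral_outer {h : ℝ → ℂ} (hi : IntegrableOn h (P.outer : Set ℝ)) :
    ∫ x in (P.outer : Set ℝ), h x = (∫ x in Ioo 0 P.L₁, h x) + ∫ x in Ioo P.L₂ P.L₃, h x :=
  setIntegral_union disjoint_outer_pieces measurableSet_Ioo (hi.mono_set subset_union_left)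
    (hi.mono_set subset_union_right)

lemma closure_mid : closure (P.mid : Set ℝ) = Icc P.L₁ P.L₂ := closure_Ioo P.L₁_lt_L₂.ne

lemma closure_outer : closure (P.outer : Set ℝ) = Icc 0 P.L₁ ∪ Icc P.L₂ P.L₃ := by
  change closure (Ioo 0 P.L₁ ∪ Ioo P.L₂ P.L₃) = _
  rw [closure_union, closure_Ioo P.L₁_pos.ne, closure_Ioo P.L₂_lt_L₃.ne]

lemma exists_hasTrace_mid {f f' : L2 P.mid} (h : HasWeakDeriv P.mid f f') (x : ℝ) :
    ∃ z, HasTrace f x z := by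
  obtain ⟨F, hF, hf⟩ := h.exists_isPrimitive P.L₁_lt_L₂ subset_rfl
  refine ⟨_, .of_continuousOn (F := F) ?_ hf x⟩
  rw [closure_mid]
  exact hF.continuousOn P.L₁_lt_L₂.le

lemma exists_hasTrace_outer {g g' : L2 P.outer} (h : HasWeakDeriv P.outer g g') (x : ℝ) :
    ∃ z, HasTrace g x z := by
  obtain ⟨F, hF, hf⟩ := h.exists_isPrimitive P.L₁_pos subset_union_left
  obtain ⟨G, hG, hg⟩ := h.exists_isPrimitive P.L₂_lt_L₃ subset_union_right
  refine ⟨_, .of_continuousOn (F := fun x => if x ≤ P.L₁ then F x else G x) ?_ ?_ x⟩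
  · rw [closure_outer]
    refine ContinuousOn.union_of_isClosed ?_ ?_ isClosed_Icc isClosed_Icc
    · exact (hF.continuousOn P.L₁_pos.le).congr fun y hy => if_pos hy.2
    · exact (hG.continuousOn P.L₂_lt_L₃.le).congr fun y hy =>
        if_neg (not_le.2 (P.L₁_lt_L₂.trans_le hy.1))
  · refine (ae_restrict_union_iff _ _ _).2 ⟨?_, ?_⟩
    · filter_upwards [hf, ae_restrict_mem measurableSet_Ioo] with y hy hy'
      rw [hy, if_pos hy'.2.le]
    · filter_upwards [hg, ae_restrict_mem measurableSet_Ioo] with y hy hy'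
      rw [hy, if_neg (not_le.2 (P.L₁_lt_L₂.trans hy'.1))]

lemma inner_mid_add {f f' g g' : L2 P.mid} (hf : HasWeakDeriv P.mid f f')
    (hg : HasWeakDeriv P.mid g g') {f₁ f₂ g₁ g₂ : ℂ} (hf₁ : HasTrace f P.L₁ f₁)
    (hf₂ : HasTrace f P.L₂ f₂) (hg₁ : HasTrace g P.L₁ g₁) (hg₂ : HasTrace g P.L₂ g₂) :
    inner ℂ f' g + inner ℂ f g' = conj f₂ * g₂ - conj f₁ * g₁ := by
  rw [← hf.integral_conj_mul_add hg P.L₁_lt_L₂ subset_rfl hf₁ hf₂ hg₁ hg₂,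
    MeasureTheory.L2.inner_def, MeasureTheory.L2.inner_def,
    ← integral_add (MeasureTheory.L2.integrable_inner _ _) (MeasureTheory.L2.integrable_inner _ _)]
  simp only [RCLike.inner_apply, mul_comm]
  rfl

lemma inner_outer_add {f f' g g' : L2 P.outer} (hf : HasWeakDeriv P.outer f f')
    (hg : HasWeakDeriv P.outer g g') {f₀ f₁ f₂ f₃ g₀ g₁ g₂ g₃ : ℂ}
    (hf₀ : HasTrace f 0 f₀) (hf₁ : HasTrace f P.L₁ f₁)
    (hf₂ : HasTrace f P.L₂ f₂) (hf₃ : HasTrace f P.L₃ f₃)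
    (hg₀ : HasTrace g 0 g₀) (hg₁ : HasTrace g P.L₁ g₁)
    (hg₂ : HasTrace g P.L₂ g₂) (hg₃ : HasTrace g P.L₃ g₃) :
    inner ℂ f' g + inner ℂ f g'
      = (conj f₁ * g₁ - conj f₀ * g₀) + (conj f₃ * g₃ - conj f₂ * g₂) := by
  have i1 := MeasureTheory.L2.integrable_inner (𝕜 := ℂ) f' g
  have i2 := MeasureTheory.L2.integrable_inner (𝕜 := ℂ) f g'
  rw [← hf.integral_conj_mul_add hg P.L₁_pos subset_union_left hf₀ hf₁ hg₀ hg₁,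
    ← hf.integral_conj_mul_add hg P.L₂_lt_L₃ subset_union_right hf₂ hf₃ hg₂ hg₃,
    MeasureTheory.L2.inner_def, MeasureTheory.L2.inner_def, ← integral_add i1 i2]
  have i3 := i1.add i2
  rw [integral_outer (h := fun x => inner ℂ (f' x) (g x) + inner ℂ (f x) (g' x)) i3]
  simp only [RCLike.inner_apply, mul_comm]

/-- The defect, tested against `φ`, of `(f', g')` from being the weak derivative of the function
which is `f` on the middle and `g` on the outer part of the bar. If it vanishes for all test
functions on the whole bar, then `f` and `g` take the same values at the interfaces
(`hasTrace_of_weakDefect`); if it vanishes for all `φ ∈ C_c^∞(ℝ)`, then moreover `g` is zero at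
both ends of the bar (`isDisplacement_of_weakDefect`). -/
def weakDefect (P : Bar) (φ : ℝ → ℝ) (f : L2 P.mid) (g : L2 P.outer) (f' : L2 P.mid)
    (g' : L2 P.outer) : ℂ :=
  (∫ x in (P.mid : Set ℝ), deriv φ x • f x) + (∫ x in (P.outer : Set ℝ), deriv φ x • g x)
    + (∫ x in (P.mid : Set ℝ), φ x • f' x) + ∫ x in (P.outer : Set ℝ), φ x • g' x

lemma weakDefect_eq_boundary {f f' : L2 P.mid} {g g' : L2 P.outer} (hf : HasWeakDeriv P.mid f f')
    (hg : HasWeakDeriv P.outer g g') {f₁ f₂ g₀ g₁ g₂ g₃ : ℂ}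
    (hf₁ : HasTrace f P.L₁ f₁) (hf₂ : HasTrace f P.L₂ f₂) (hg₀ : HasTrace g 0 g₀)
    (hg₁ : HasTrace g P.L₁ g₁) (hg₂ : HasTrace g P.L₂ g₂) (hg₃ : HasTrace g P.L₃ g₃)
    {φ : ℝ → ℝ} (hφ : ContDiff ℝ ∞ φ) (hs : HasCompactSupport φ) :
    P.weakDefect φ f g f' g'
      = φ P.L₁ * (g₁ - f₁) + φ P.L₂ * (f₂ - g₂) + φ P.L₃ * g₃ - φ 0 * g₀ := by
  have hc' := hφ.continuous_deriv (by simp)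
  have i1 := integrable_smul hc' hs.deriv g
  have i2 := integrable_smul hφ.continuous hs g'
  have e1 := hf.integral_smul_add P.L₁_lt_L₂ subset_rfl hf₁ hf₂ hφ
  have e2 := hg.integral_smul_add P.L₁_pos subset_union_left hg₀ hg₁ hφ
  have e3 := hg.integral_smul_add P.L₂_lt_L₃ subset_union_right hg₂ hg₃ hφ
  have e4 := integral_outer (h := fun x => deriv φ x • g x + φ x • g' x) (i1.add i2)
  rw [integral_add i1 i2, e2, e3] at e4
  have e5 := integral_add (integrable_smul hc' hs.deriv f) (integrable_smul hφ.continuous hs f')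
  have e6 := e5.symm.trans e1
  rw [weakDefect]
  linear_combination e6 + e4

lemma exists_bump {s : Set ℝ} {x : ℝ} (hs : s ∈ 𝓝 x) :
    ∃ φ : ℝ → ℝ, ContDiff ℝ ∞ φ ∧ HasCompactSupport φ ∧ tsupport φ ⊆ s ∧ φ x = 1 := by
  obtain ⟨φ, h1, h2, h3, -, h4⟩ := exists_contDiff_tsupport_subset (n := ⊤) hs
  exact ⟨φ, h3, h2, h1, h4⟩

lemma hasWeakDeriv_of_weakDefect {f f' : L2 P.mid} {g g' : L2 P.outer}
    (h : ∀ φ, IsTest P.whole φ → P.weakDefect φ f g f' g' = 0) :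
    HasWeakDeriv P.mid f f' ∧ HasWeakDeriv P.outer g g' := by
  have hz : ∀ {Ω : TopologicalSpace.Opens ℝ} (k : L2 Ω) (ψ : ℝ → ℝ),
      (∀ x ∈ Ω, ψ x = 0) → ∫ x in (Ω : Set ℝ), ψ x • k x = 0 := fun {Ω} k ψ hψ =>
    setIntegral_eq_zero_of_forall_eq_zero fun x hx => by rw [hψ x hx, zero_smul]
  refine ⟨fun φ hφ => ?_, fun φ hφ => ?_⟩
  · have h1 := h φ (hφ.mono mid_subset_whole)
    have hn : ∀ x ∈ P.outer, x ∉ P.mid := fun x hx hx' =>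
      Set.disjoint_left.1 disjoint_mid_outer hx' hx
    rw [weakDefect, hz g _ fun x hx => hφ.deriv_eq_zero (hn x hx),
      hz g' _ fun x hx => hφ.eq_zero (hn x hx)] at h1
    linear_combination h1
  · have h1 := h φ (hφ.mono outer_subset_whole)
    have hn : ∀ x ∈ P.mid, x ∉ P.outer := fun x hx hx' =>
      Set.disjoint_left.1 disjoint_mid_outer hx hx'
    rw [weakDefect, hz f _ fun x hx => hφ.deriv_eq_zero (hn x hx),
      hz f' _ fun x hx => hφ.eq_zero (hn x hx)] at h1
    linear_combination h1

/-- If `(f, g)` has a weak derivative on the whole bar, then `f` and `g` take the same values at the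
interfaces. -/
lemma hasTrace_of_weakDefect {f f' : L2 P.mid} {g g' : L2 P.outer}
    (h : ∀ φ, IsTest P.whole φ → P.weakDefect φ f g f' g' = 0) :
    (∃ z, HasTrace f P.L₁ z ∧ HasTrace g P.L₁ z) ∧
      ∃ z, HasTrace f P.L₂ z ∧ HasTrace g P.L₂ z := by
  obtain ⟨hf, hg⟩ := hasWeakDeriv_of_weakDefect h
  obtain ⟨f₁, hf₁⟩ := exists_hasTrace_mid hf P.L₁
  obtain ⟨f₂, hf₂⟩ := exists_hasTrace_mid hf P.L₂
  obtain ⟨g₀, hg₀⟩ := exists_hasTrace_outer hg 0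
  obtain ⟨g₁, hg₁⟩ := exists_hasTrace_outer hg P.L₁
  obtain ⟨g₂, hg₂⟩ := exists_hasTrace_outer hg P.L₂
  obtain ⟨g₃, hg₃⟩ := exists_hasTrace_outer hg P.L₃
  have key : ∀ φ, IsTest P.whole φ → (φ P.L₁ : ℂ) * (g₁ - f₁) + φ P.L₂ * (f₂ - g₂) = 0 := by
    intro φ hφ
    have h1 := h φ hφ
    have z0 : φ 0 = 0 := hφ.eq_zero fun hx => hx.1.false
    have z3 : φ P.L₃ = 0 := hφ.eq_zero fun hx => hx.2.false
    rw [weakDefect_eq_boundary hf hg hf₁ hf₂ hg₀ hg₁ hg₂ hg₃ hφ.smooth hφ.compact, z0, z3] at h1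
    simpa using h1
  refine ⟨⟨f₁, hf₁, ?_⟩, ⟨f₂, hf₂, ?_⟩⟩
  · obtain ⟨φ, a1, a2, a3, a4⟩ := exists_bump (Ioo_mem_nhds P.L₁_pos P.L₁_lt_L₂)
    have h1 := key φ ⟨a1, a2, a3.trans (Ioo_subset_Ioo_right P.L₂_lt_L₃.le)⟩
    have z2 : φ P.L₂ = 0 := image_eq_zero_of_notMem_tsupport fun hx => (a3 hx).2.false
    rw [a4, z2, Complex.ofReal_one, one_mul, Complex.ofReal_zero, zero_mul, add_zero,
      sub_eq_zero] at h1
    rwa [← h1]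
  · obtain ⟨φ, a1, a2, a3, a4⟩ := exists_bump (Ioo_mem_nhds P.L₁_lt_L₂ P.L₂_lt_L₃)
    have h1 := key φ ⟨a1, a2, a3.trans (Ioo_subset_Ioo_left P.L₁_pos.le)⟩
    have z1 : φ P.L₁ = 0 := image_eq_zero_of_notMem_tsupport fun hx => (a3 hx).1.false
    rw [a4, z1, Complex.ofReal_one, one_mul, Complex.ofReal_zero, zero_mul, zero_add,
      sub_eq_zero] at h1
    rwa [h1] at hf₂ ⊢

/-- Testing against functions that do not vanish at the ends of the bar encodes the boundary
conditions of a displacement. -/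
lemma isDisplacement_of_weakDefect {f f' : L2 P.mid} {g g' : L2 P.outer}
    (h : ∀ φ, ContDiff ℝ ∞ φ → HasCompactSupport φ → P.weakDefect φ f g f' g' = 0) :
    P.IsDisplacement f g := by
  have h' : ∀ φ, IsTest P.whole φ → P.weakDefect φ f g f' g' = 0 := fun φ hφ =>
    h φ hφ.smooth hφ.compact
  obtain ⟨hf, hg⟩ := hasWeakDeriv_of_weakDefect h'
  obtain ⟨⟨z₁, hf₁, hg₁⟩, z₂, hf₂, hg₂⟩ := hasTrace_of_weakDefect h'
  obtain ⟨g₀, hg₀⟩ := exists_hasTrace_outer hg 0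
  obtain ⟨g₃, hg₃⟩ := exists_hasTrace_outer hg P.L₃
  have key : ∀ φ : ℝ → ℝ, ContDiff ℝ ∞ φ → HasCompactSupport φ →
      (φ P.L₃ : ℂ) * g₃ - φ 0 * g₀ = 0 := by
    intro φ h1 h2
    have h3 := h φ h1 h2
    rw [weakDefect_eq_boundary hf hg hf₁ hf₂ hg₀ hg₁ hg₂ hg₃ h1 h2] at h3
    simpa using h3
  refine ⟨⟨_, hf⟩, ⟨_, hg⟩, ?_, ?_, ⟨z₁, hf₁, hg₁⟩, ⟨z₂, hf₂, hg₂⟩⟩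
  · obtain ⟨φ, a1, a2, a3, a4⟩ := exists_bump (Iio_mem_nhds P.L₃_pos)
    have h1 := key φ a1 a2
    have z3 : φ P.L₃ = 0 := image_eq_zero_of_notMem_tsupport fun hx => self_notMem_Iio (a3 hx)
    rw [a4, z3] at h1
    have : g₀ = 0 := by simpa using h1
    rwa [this] at hg₀
  · obtain ⟨φ, a1, a2, a3, a4⟩ := exists_bump (Ioi_mem_nhds P.L₃_pos)
    have h1 := key φ a1 a2
    have z0 : φ 0 = 0 := image_eq_zero_of_notMem_tsupport fun hx => self_notMem_Ioi (a3 hx)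
    rw [a4, z0] at h1
    have : g₃ = 0 := by simpa using h1
    rwa [this] at hg₃

lemma IsDisplacement.weakDefect_eq_zero {f f' : L2 P.mid} {g g' : L2 P.outer}
    (h : P.IsDisplacement f g) (hf : HasWeakDeriv P.mid f f') (hg : HasWeakDeriv P.outer g g')
    {φ : ℝ → ℝ} (hφ : ContDiff ℝ ∞ φ) (hs : HasCompactSupport φ) :
    P.weakDefect φ f g f' g' = 0 := by
  obtain ⟨-, -, h₀, h₃, ⟨z₁, hf₁, hg₁⟩, z₂, hf₂, hg₂⟩ := h
  rw [weakDefect_eq_boundary hf hg hf₁ hf₂ h₀ hg₁ hg₂ h₃ hφ hs]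
  ring

lemma weakDefect_add (φ : ℝ → ℝ) (hφ : ContDiff ℝ ∞ φ) (hs : HasCompactSupport φ)
    (f₁ f₂ : L2 P.mid) (g₁ g₂ : L2 P.outer) (f₁' f₂' : L2 P.mid) (g₁' g₂' : L2 P.outer) :
    P.weakDefect φ (f₁ + f₂) (g₁ + g₂) (f₁' + f₂') (g₁' + g₂')
      = P.weakDefect φ f₁ g₁ f₁' g₁' + P.weakDefect φ f₂ g₂ f₂' g₂' := by
  have hc' := hφ.continuous_deriv (by simp)
  simp only [weakDefect, Cattaneo.integral_smul_add hc' hs.deriv,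
    Cattaneo.integral_smul_add hφ.continuous hs]
  ring

lemma weakDefect_smul (φ : ℝ → ℝ) (c : ℂ) (f : L2 P.mid) (g : L2 P.outer) (f' : L2 P.mid)
    (g' : L2 P.outer) :
    P.weakDefect φ (c • f) (c • g) (c • f') (c • g') = c * P.weakDefect φ f g f' g' := by
  simp only [weakDefect, integral_smul_smul, smul_eq_mul]
  ring

lemma weakDefect_zero (φ : ℝ → ℝ) : P.weakDefect φ 0 0 0 0 = 0 := by
  simpa using P.weakDefect_smul φ 0 0 0 0 0

lemma continuous_weakDefect {φ : ℝ → ℝ} (hφ : ContDiff ℝ ∞ φ) (hs : HasCompactSupport φ) :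
    Continuous fun x : L2 P.mid × L2 P.outer × L2 P.mid × L2 P.outer =>
      P.weakDefect φ x.1 x.2.1 x.2.2.1 x.2.2.2 := by
  have hc' := hφ.continuous_deriv (by simp)
  have c1 := fun Ω => continuous_integral_smul (Ω := Ω) hc' hs.deriv
  have c2 := fun Ω => continuous_integral_smul (Ω := Ω) hφ.continuous hs
  exact ((((c1 P.mid).comp continuous_fst).add ((c1 P.outer).comp (by fun_prop))).add
    ((c2 P.mid).comp (by fun_prop))).add ((c2 P.outer).comp (by fun_prop))

/-! ### Completeness of the energy space -/

lemma volume_ne_top_of_subset {s : Set ℝ} (h : s ⊆ (P.whole : Set ℝ)) :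
    volume s ≠ ⊤ := ((measure_mono h).trans_lt measure_Ioo_lt_top).ne

namespace EnergySpace

lemma inner_def (U V : P.EnergySpace) : inner ℂ U V = energyInner U V := rfl

lemma norm_sq (U : P.EnergySpace) :
    ‖U‖ ^ 2 = P.a * ‖du₁ U‖ ^ 2 + ‖u₂ U‖ ^ 2 + ‖θ U‖ ^ 2 + P.τ * ‖q U‖ ^ 2
      + P.b * ‖dv₁ U‖ ^ 2 + ‖v₂ U‖ ^ 2 := by
  rw [← inner_self_eq_norm_sq (𝕜 := ℂ) U, inner_def, energyInner_self]
  exact Complex.ofReal_re _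

lemma uniformContinuous_of_sq_le {E : Type*} [NormedAddCommGroup E] [NormedSpace ℂ E]
    (L : P.EnergySpace →ₗ[ℂ] E) {c : ℝ} (hc : 0 < c) (h : ∀ U, c * ‖L U‖ ^ 2 ≤ ‖U‖ ^ 2) :
    UniformContinuous L := by
  have hb : ∀ U, ‖L U‖ ≤ (√c)⁻¹ * ‖U‖ := fun U => by
    rw [inv_mul_eq_div, le_div_iff₀' (Real.sqrt_pos.2 hc)]
    refine (sq_le_sq₀ (by positivity) (norm_nonneg _)).1 ?_
    rw [mul_pow, Real.sq_sqrt hc.le]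
    exact h U
  exact (L.mkContinuous _ hb).uniformContinuous

lemma sq_le_norm_sq (U : P.EnergySpace) :
    P.a * ‖du₁ U‖ ^ 2 ≤ ‖U‖ ^ 2 ∧ P.b * ‖dv₁ U‖ ^ 2 ≤ ‖U‖ ^ 2 ∧ 1 * ‖θ U‖ ^ 2 ≤ ‖U‖ ^ 2 ∧
      P.τ * ‖q U‖ ^ 2 ≤ ‖U‖ ^ 2 ∧ 1 * ‖u₂ U‖ ^ 2 ≤ ‖U‖ ^ 2 ∧ 1 * ‖v₂ U‖ ^ 2 ≤ ‖U‖ ^ 2 := by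
  have h := norm_sq U
  have h1 : 0 ≤ P.a * ‖du₁ U‖ ^ 2 := mul_nonneg P.a_pos.le (sq_nonneg _)
  have h2 : 0 ≤ P.b * ‖dv₁ U‖ ^ 2 := mul_nonneg P.b_pos.le (sq_nonneg _)
  have h3 : 0 ≤ P.τ * ‖q U‖ ^ 2 := mul_nonneg P.τ_pos.le (sq_nonneg _)
  have h4 := sq_nonneg ‖θ U‖
  have h5 := sq_nonneg ‖u₂ U‖
  have h6 := sq_nonneg ‖v₂ U‖
  refine ⟨?_, ?_, ?_, ?_, ?_, ?_⟩ <;> linarith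

lemma uniformContinuous_du₁ : UniformContinuous (du₁ (P := P)) :=
  uniformContinuous_of_sq_le _ P.a_pos fun U => (sq_le_norm_sq U).1

lemma uniformContinuous_dv₁ : UniformContinuous (dv₁ (P := P)) :=
  uniformContinuous_of_sq_le _ P.b_pos fun U => (sq_le_norm_sq U).2.1

lemma uniformContinuous_θ : UniformContinuous (θ (P := P)) :=
  uniformContinuous_of_sq_le _ one_pos fun U => (sq_le_norm_sq U).2.2.1

lemma uniformContinuous_q : UniformContinuous (q (P := P)) :=
  uniformContinuous_of_sq_le _ P.τ_pos fun U => (sq_le_norm_sq U).2.2.2.1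

lemma uniformContinuous_u₂ : UniformContinuous (u₂ (P := P)) :=
  uniformContinuous_of_sq_le _ one_pos fun U => (sq_le_norm_sq U).2.2.2.2.1

lemma uniformContinuous_v₂ : UniformContinuous (v₂ (P := P)) :=
  uniformContinuous_of_sq_le _ one_pos fun U => (sq_le_norm_sq U).2.2.2.2.2

lemma exists_of_isDisplacement {f f' : L2 P.mid} {g g' : L2 P.outer} (h : P.IsDisplacement f g)
    (hf : HasWeakDeriv P.mid f f') (hg : HasWeakDeriv P.outer g g') (t p y : L2 P.mid)
    (z : L2 P.outer) :
    ∃ U : P.EnergySpace, u₁ U = f ∧ v₁ U = g ∧ θ U = t ∧ q U = p ∧ u₂ U = y ∧ v₂ U = z ∧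
      du₁ U = f' ∧ dv₁ U = g' := by
  let U : P.EnergySpace := (⟨(f, g, t, p, y, z), h⟩ : P.stateSubmodule)
  exact ⟨U, rfl, rfl, rfl, rfl, rfl, rfl, (hasWeakDeriv_u₁ U).unique hf,
    (hasWeakDeriv_v₁ U).unique hg⟩

lemma integral_derivative_eq_zero (U : P.EnergySpace) :
    (∫ x in (P.mid : Set ℝ), du₁ U x) + ∫ x in (P.outer : Set ℝ), dv₁ U x = 0 := by
  obtain ⟨-, -, h₀, h₃, ⟨z₁, hu₁, hv₁⟩, z₂, hu₂, hv₂⟩ := U.isDisplacement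
  have hi : IntegrableOn (dv₁ U) (P.outer : Set ℝ) :=
    (dv₁ U).integrableOn (volume_ne_top_of_subset outer_subset_whole)
  have e1 : ∫ x in (P.mid : Set ℝ), du₁ U x = _ :=
    (hasWeakDeriv_u₁ U).integral_eq_sub P.L₁_lt_L₂ subset_rfl hu₁ hu₂
  have e2 := (hasWeakDeriv_v₁ U).integral_eq_sub P.L₁_pos subset_union_left h₀ hv₁
  have e3 := (hasWeakDeriv_v₁ U).integral_eq_sub P.L₂_lt_L₃ subset_union_right hv₂ h₃
  have e4 := integral_outer hi
  rw [e4, e2, e3]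
  linear_combination e1

end EnergySpace

/-- Every pair of `L²` functions with vanishing total integral is the derivative of a
displacement, the primitive which vanishes at `0`. -/
lemma exists_isDisplacement (f' : L2 P.mid) (g' : L2 P.outer)
    (h : (∫ x in (P.mid : Set ℝ), f' x) + ∫ x in (P.outer : Set ℝ), g' x = 0) :
    ∃ f g, P.IsDisplacement f g ∧ HasWeakDeriv P.mid f f' ∧ HasWeakDeriv P.outer g g' := by
  have hm := P.mid.isOpen.measurableSet
  have ho := P.outer.isOpen.measurableSet
  set w : ℝ → ℂ := (P.mid : Set ℝ).indicator f' + (P.outer : Set ℝ).indicator g' with hw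
  have hfi : IntegrableOn f' (P.mid : Set ℝ) :=
    f'.integrableOn (volume_ne_top_of_subset mid_subset_whole)
  have hgi : IntegrableOn g' (P.outer : Set ℝ) :=
    g'.integrableOn (volume_ne_top_of_subset outer_subset_whole)
  have i1 := (integrable_indicator_iff hm).2 hfi
  have i2 := (integrable_indicator_iff ho).2 hgi
  have hwi : Integrable w := i1.add i2
  have hF : IsPrimitive (fun x => ∫ t in (0 : ℝ)..x, w t) w 0 P.L₃ :=
    ⟨hwi.intervalIntegrable, fun x _ => by simp⟩
  set F : ℝ → ℂ := fun x => ∫ t in (0 : ℝ)..x, w t with hFdef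
  have hFc := hF.continuousOn P.L₃_pos.le
  have hF0 : F 0 = 0 := intervalIntegral.integral_same
  have hF3 : F P.L₃ = 0 := by
    change ∫ t in (0 : ℝ)..P.L₃, w t = 0
    rw [intervalIntegral.integral_of_le P.L₃_pos.le, integral_Ioc_eq_integral_Ioo]
    change ∫ t in (P.whole : Set ℝ), _ = _
    have e1 := setIntegral_indicator (s := (P.whole : Set ℝ)) hm (f := f') (μ := volume)
    have e2 := setIntegral_indicator (s := (P.whole : Set ℝ)) ho (f := g') (μ := volume)
    rw [inter_eq_right.2 mid_subset_whole] at e1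
    rw [inter_eq_right.2 outer_subset_whole] at e2
    rw [← h, ← e1, ← e2]
    exact integral_add i1.integrableOn i2.integrableOn
  have hmid : closure (P.mid : Set ℝ) ⊆ Icc 0 P.L₃ := by
    rw [closure_mid]
    exact Icc_subset_Icc P.L₁_pos.le P.L₂_lt_L₃.le
  have hout : closure (P.outer : Set ℝ) ⊆ Icc 0 P.L₃ := by
    rw [closure_outer]
    exact union_subset (Icc_subset_Icc_right P.L₁_lt_L₃.le) (Icc_subset_Icc_left P.L₂_pos.le)
  have m1 := memLp_two_of_continuousOn hFc hm (subset_closure.trans hmid)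
  have m2 := memLp_two_of_continuousOn hFc ho (subset_closure.trans hout)
  have d1 : HasWeakDeriv P.mid (m1.toLp F) f' := by
    refine hF.hasWeakDeriv P.L₃_pos.le mid_subset_whole m1.coeFn_toLp ?_
    filter_upwards [ae_restrict_mem hm] with x hx
    rw [hw, Pi.add_apply, indicator_of_mem hx,
      indicator_of_notMem (Set.disjoint_left.1 disjoint_mid_outer hx), add_zero]
  have d2 : HasWeakDeriv P.outer (m2.toLp F) g' := by
    refine hF.hasWeakDeriv P.L₃_pos.le outer_subset_whole m2.coeFn_toLp ?_
    filter_upwards [ae_restrict_mem ho] with x hx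
    rw [hw, Pi.add_apply, indicator_of_mem hx,
      indicator_of_notMem (fun hx' => Set.disjoint_left.1 disjoint_mid_outer hx' hx), zero_add]
  have t1 := fun x => HasTrace.of_continuousOn (hFc.mono hmid) m1.coeFn_toLp x
  have t2 := fun x => HasTrace.of_continuousOn (hFc.mono hout) m2.coeFn_toLp x
  refine ⟨m1.toLp F, m2.toLp F, ⟨⟨_, d1⟩, ⟨_, d2⟩, ?_, ?_, ⟨_, t1 _, t2 _⟩, ⟨_, t1 _, t2 _⟩⟩,
    d1, d2⟩
  · simpa only [hF0] using t2 0
  · simpa only [hF3] using t2 P.L₃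

lemma continuous_setIntegral {Ω : TopologicalSpace.Opens ℝ} (hΩ : volume (Ω : Set ℝ) ≠ ⊤) :
    Continuous fun f : L2 Ω => ∫ x in (Ω : Set ℝ), f x := by
  have hΩ' : (volume.restrict (Ω : Set ℝ)) univ ≠ ⊤ := by rwa [Measure.restrict_apply_univ]
  have e : ∀ f : L2 Ω, ∫ x in (Ω : Set ℝ), f x
      = inner ℂ (indicatorConstLp 2 MeasurableSet.univ hΩ' (1 : ℂ)) f := fun f => by
    rw [MeasureTheory.L2.inner_indicatorConstLp_one, Measure.restrict_univ]
  simp_rw [e]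
  fun_prop

open EnergySpace in
/-- In terms of `(u¹ₓ, v¹ₓ, θ, q, u², v²)` the energy space is the closed subspace of a product of
`L²` spaces on which `∫ u¹ₓ + ∫ v¹ₓ = 0`. -/
theorem completeSpace_energySpace (P : Bar) : CompleteSpace P.EnergySpace := by
  refine Metric.complete_of_cauchySeq_tendsto fun U hU => ?_
  obtain ⟨f', hf'⟩ := cauchySeq_tendsto_of_complete (uniformContinuous_du₁.comp_cauchySeq hU)
  obtain ⟨g', hg'⟩ := cauchySeq_tendsto_of_complete (uniformContinuous_dv₁.comp_cauchySeq hU)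
  obtain ⟨t, ht⟩ := cauchySeq_tendsto_of_complete (uniformContinuous_θ.comp_cauchySeq hU)
  obtain ⟨p, hp⟩ := cauchySeq_tendsto_of_complete (uniformContinuous_q.comp_cauchySeq hU)
  obtain ⟨y, hy⟩ := cauchySeq_tendsto_of_complete (uniformContinuous_u₂.comp_cauchySeq hU)
  obtain ⟨z, hz⟩ := cauchySeq_tendsto_of_complete (uniformContinuous_v₂.comp_cauchySeq hU)
  have h0 : (∫ x in (P.mid : Set ℝ), f' x) + ∫ x in (P.outer : Set ℝ), g' x = 0 := by
    have c1 := ((continuous_setIntegral (volume_ne_top_of_subset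
      (P.mid_subset_whole))).tendsto f').comp hf'
    have c2 := ((continuous_setIntegral (volume_ne_top_of_subset
      (P.outer_subset_whole))).tendsto g').comp hg'
    refine tendsto_nhds_unique (c1.add c2) ?_
    refine tendsto_const_nhds.congr fun n => ?_
    exact (integral_derivative_eq_zero (U n)).symm
  obtain ⟨f, g, hfg, hf, hg⟩ := exists_isDisplacement f' g' h0
  obtain ⟨V, -, -, e3, e4, e5, e6, e1, e2⟩ := exists_of_isDisplacement hfg hf hg t p y z
  refine ⟨V, ?_⟩
  have hn : ∀ {E : Type} [NormedAddCommGroup E] {k : ℕ → E} {l : E}, Tendsto k atTop (𝓝 l) →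
      Tendsto (fun n => ‖k n - l‖ ^ 2) atTop (𝓝 0) := fun {E} _ {k l} hk => by
    simpa using (tendsto_iff_norm_sub_tendsto_zero.1 hk).pow 2
  have h1 : Tendsto (fun n => ‖U n - V‖ ^ 2) atTop (𝓝 0) := by
    simp_rw [norm_sq, map_sub, e1, e2, e3, e4, e5, e6]
    simpa using ((((((hn hf').const_mul P.a).add (hn hy)).add (hn ht)).add
      ((hn hp).const_mul P.τ)).add ((hn hg').const_mul P.b)).add (hn hz)
  rw [tendsto_iff_norm_sub_tendsto_zero]
  simpa using h1.sqrt

open EnergySpace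

/-! ### Dissipativity -/

lemma IsImage.hasWeakDeriv_θ {U F : P.EnergySpace} (h : P.IsImage U F) :
    HasWeakDeriv P.mid (θ U) ((-(P.k / P.τ : ℂ))⁻¹ • (q F + (1 / P.τ : ℂ) • q U)) := by
  have hk : (P.k : ℂ) ≠ 0 := Complex.ofReal_ne_zero.2 P.k_pos.ne'
  have hτ : (P.τ : ℂ) ≠ 0 := Complex.ofReal_ne_zero.2 P.τ_pos.ne'
  refine HasWeakDeriv.of_smul (neg_ne_zero.2 (div_ne_zero hk hτ)) ?_
  rw [neg_smul]
  exact h.row₄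

lemma IsImage.hasWeakDeriv_q {U F : P.EnergySpace} (h : P.IsImage U F) :
    HasWeakDeriv P.mid (q U) ((P.k : ℂ)⁻¹ • (-(θ F + (P.m : ℂ) • du₁ F))) := by
  refine HasWeakDeriv.of_smul (Complex.ofReal_ne_zero.2 P.k_pos.ne') ?_
  have h1 := (h.row₃.smul (-1)).add ((hasWeakDeriv_u₁ F).smul (-(P.m : ℂ)))
  rw [h.row₁] at h1
  convert h1 using 1 <;> module

/-- The energy is dissipated at the rate `‖q‖²`: after integration by parts all boundary terms
cancel by the transmission conditions. -/
lemma re_inner_operator_eq {U F : P.EnergySpace} (h : P.IsImage U F)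
    (hb : P.BoundaryConditions U) : (inner ℂ F U).re = -‖q U‖ ^ 2 := by
  have hk : (P.k : ℂ) ≠ 0 := Complex.ofReal_ne_zero.2 P.k_pos.ne'
  have hτ : (P.τ : ℂ) ≠ 0 := Complex.ofReal_ne_zero.2 P.τ_pos.ne'
  obtain ⟨-, -, h₀, h₃, ⟨z₁, hu₁, hv₁⟩, z₂, hu₂, hv₂⟩ := F.isDisplacement
  obtain ⟨s₁, t₁, r₁, hs₁, ht₁, hr₁, e₁⟩ := hb.force₁
  obtain ⟨s₂, t₂, r₂, hs₂, ht₂, hr₂, e₂⟩ := hb.force₂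
  have hσ : ∀ {x : ℝ} {s t : ℂ}, HasTrace (du₁ U) x s → HasTrace (θ U) x t →
      HasTrace ((P.a : ℂ) • du₁ U - (P.m : ℂ) • θ U) x (P.a * s - P.m * t) := by
    intro x s t hs ht
    have h1 := (hs.smul (P.a : ℂ)).add (ht.smul (-(P.m : ℂ)))
    convert h1 using 1
    · module
    · ring
  obtain ⟨r₀, hr₀⟩ := exists_hasTrace_outer h.row₆ 0
  obtain ⟨r₃, hr₃⟩ := exists_hasTrace_outer h.row₆ P.L₃
  have A1 := inner_mid_add (hasWeakDeriv_u₁ F) h.row₅ hu₁ hu₂ (hσ hs₁ ht₁) (hσ hs₂ ht₂)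
  have A2 := inner_outer_add (hasWeakDeriv_v₁ F) h.row₆ h₀ hv₁ hv₂ h₃ hr₀
    (hr₁.smul (P.b : ℂ)) (hr₂.smul (P.b : ℂ)) hr₃
  have A3 := inner_mid_add h.hasWeakDeriv_q h.hasWeakDeriv_θ hb.flux₁ hb.flux₂ ht₁ ht₂
  rw [h.row₁, inner_sub_right, inner_smul_right, inner_smul_right, e₁, e₂] at A1
  rw [h.row₂, inner_smul_right, map_zero, zero_mul, zero_mul, sub_zero, zero_sub] at A2
  have A4 : inner ℂ (θ F) (θ U) + P.m * inner ℂ (du₁ F) (θ U) + P.τ * inner ℂ (q U) (q F)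
      + inner ℂ (q U) (q U) = 0 := by
    simp only [inner_smul_left, inner_smul_right, inner_neg_left, inner_add_left, inner_add_right,
      map_inv₀, Complex.conj_ofReal, map_zero, zero_mul, sub_zero] at A3
    field_simp at A3
    linear_combination -A3
  have A5 : inner ℂ (q U) (q U) = ((‖q U‖ ^ 2 : ℝ) : ℂ) := by
    rw [inner_self_eq_norm_sq_to_K]
    push_cast
    rfl
  rw [A5] at A4
  have A6 := congrArg Complex.re (congrArg₂ (· + ·) (congrArg₂ (· + ·) A1 A2) A4)
  have s1 : (inner ℂ (u₂ F) (u₂ U)).re = (inner ℂ (u₂ U) (u₂ F)).re := inner_re_symm (𝕜 := ℂ) _ _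
  have s2 : (inner ℂ (v₂ F) (v₂ U)).re = (inner ℂ (v₂ U) (v₂ F)).re := inner_re_symm (𝕜 := ℂ) _ _
  have s3 : (inner ℂ (q F) (q U)).re = (inner ℂ (q U) (q F)).re := inner_re_symm (𝕜 := ℂ) _ _
  rw [EnergySpace.inner_def, energyInner]
  simp only [Complex.add_re, Complex.sub_re, Complex.neg_re, Complex.re_ofReal_mul,
    Complex.ofReal_re, Complex.zero_re, s1, s2, s3] at A6 ⊢
  linarith

lemma isDissipative_operator (P : Bar) : IsDissipative P.operator := by
  intro U F h
  obtain ⟨h1, h2⟩ := P.mem_graph_operator.1 h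
  rw [re_inner_operator_eq h1 h2]
  exact neg_nonpos.2 (sq_nonneg _)

/-! ### The range condition -/

lemma exists_smooth_vector {Ω : TopologicalSpace.Opens ℝ} (hΩ : (Ω : Set ℝ) ⊆ P.whole) {φ : ℝ → ℝ}
    (hφ : ContDiff ℝ ∞ φ) (hs : HasCompactSupport φ) :
    ∃ f f' : L2 Ω, HasWeakDeriv Ω f f' ∧ (∀ x, HasTrace f x (φ x)) ∧
      (∀ g, inner ℂ f g = ∫ x in (Ω : Set ℝ), φ x • g x) ∧
      ∀ g, inner ℂ f' g = ∫ x in (Ω : Set ℝ), deriv φ x • g x := by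
  have h := memLp_ofReal hφ.continuous hs Ω
  have h' := memLp_ofReal (hφ.continuous_deriv (by simp)) hs.deriv Ω
  exact ⟨h.toLp _, h'.toLp _, hasWeakDeriv_toLp P.L₃_pos.le hΩ hφ h h',
    hasTrace_toLp hφ.continuous h, inner_toLp_ofReal h, inner_toLp_ofReal h'⟩

lemma hasTrace_zero_eq_zero {x : ℝ} (hx : x ∈ Icc 0 P.L₁ ∪ Icc P.L₂ P.L₃) {z : ℂ}
    (h : HasTrace (0 : L2 P.outer) x z) : z = 0 := by
  have h0 : ((0 : L2 P.outer) : ℝ → ℂ) =ᵐ[volume.restrict (P.outer : Set ℝ)] fun _ => 0 :=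
    Lp.coeFn_zero _ _ _
  rcases hx with hx | hx
  · exact (h.eq_of_continuousOn P.L₁_pos subset_union_left continuousOn_const
      (ae_restrict_of_ae_restrict_of_subset subset_union_left h0) hx).symm
  · exact (h.eq_of_continuousOn P.L₂_lt_L₃ subset_union_right continuousOn_const
      (ae_restrict_of_ae_restrict_of_subset subset_union_right h0) hx).symm

/-- The vectors `[z, ζ, -(k p + m z)ₓ, c p, z, ζ]` for a displacement `(z, ζ)` and `p ∈ H¹₀(L₁,
L₂)`. The relations between the components are expressed through `weakDefect` (with `p` extended
by zero), so that the subspace is visibly closed. -/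
def variationSpace (P : Bar) (c : ℂ) : Submodule ℂ P.EnergySpace where
  carrier := {V | ∀ φ : ℝ → ℝ, ContDiff ℝ ∞ φ → HasCompactSupport φ →
    P.weakDefect φ (u₂ V) (v₂ V) (du₁ V) (dv₁ V) = 0 ∧
      P.weakDefect φ (((P.k : ℂ) * c⁻¹) • q V) 0 (-(θ V + (P.m : ℂ) • du₁ V)) 0 = 0}
  add_mem' := by
    intro V W hV hW φ h1 h2
    obtain ⟨a1, a2⟩ := hV φ h1 h2
    obtain ⟨b1, b2⟩ := hW φ h1 h2
    constructor
    · simp only [map_add]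
      rw [weakDefect_add φ h1 h2, a1, b1, add_zero]
    · have := weakDefect_add φ h1 h2 (((P.k : ℂ) * c⁻¹) • q V) (((P.k : ℂ) * c⁻¹) • q W) 0 0
        (-(θ V + (P.m : ℂ) • du₁ V)) (-(θ W + (P.m : ℂ) • du₁ W)) 0 0
      rw [a2, b2, add_zero, add_zero] at this
      rw [← this]
      simp only [map_add]
      congr 1 <;> module
  zero_mem' := by
    intro φ _ _
    simp [weakDefect_zero]
  smul_mem' := by
    intro r V hV φ h1 h2
    obtain ⟨a1, a2⟩ := hV φ h1 h2
    constructor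
    · simp only [map_smul]
      rw [weakDefect_smul, a1, mul_zero]
    · have := P.weakDefect_smul φ r (((P.k : ℂ) * c⁻¹) • q V) 0 (-(θ V + (P.m : ℂ) • du₁ V)) 0
      rw [a2, mul_zero, smul_zero] at this
      rw [← this]
      simp only [map_smul]
      congr 1 <;> module

lemma isClosed_variationSpace (P : Bar) (c : ℂ) :
    IsClosed (P.variationSpace c : Set P.EnergySpace) := by
  have c1 := (uniformContinuous_du₁ (P := P)).continuous
  have c2 := (uniformContinuous_dv₁ (P := P)).continuous
  have c3 := (uniformContinuous_θ (P := P)).continuous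
  have c4 := (uniformContinuous_q (P := P)).continuous
  have c5 := (uniformContinuous_u₂ (P := P)).continuous
  have c6 := (uniformContinuous_v₂ (P := P)).continuous
  have d4 : Continuous fun V : P.EnergySpace => ((P.k : ℂ) * c⁻¹) • q V :=
    (continuous_const_smul _).comp c4
  have d3 : Continuous fun V : P.EnergySpace => -(θ V + (P.m : ℂ) • du₁ V) :=
    (c3.add ((continuous_const_smul (P.m : ℂ)).comp c1)).neg
  have k1 : ∀ φ : ℝ → ℝ, ContDiff ℝ ∞ φ → HasCompactSupport φ → IsClosed {V : P.EnergySpace |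
      P.weakDefect φ (u₂ V) (v₂ V) (du₁ V) (dv₁ V) = 0} := fun φ h1 h2 =>
    have k : Continuous fun V : P.EnergySpace => (u₂ V, v₂ V, du₁ V, dv₁ V) :=
      c5.prodMk (c6.prodMk (c1.prodMk c2))
    isClosed_singleton.preimage ((continuous_weakDefect h1 h2).comp k)
  have k2 : ∀ φ : ℝ → ℝ, ContDiff ℝ ∞ φ → HasCompactSupport φ → IsClosed {V : P.EnergySpace |
      P.weakDefect φ (((P.k : ℂ) * c⁻¹) • q V) 0 (-(θ V + (P.m : ℂ) • du₁ V)) 0 = 0} :=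
    fun φ h1 h2 =>
    have k : Continuous fun V : P.EnergySpace => (((P.k : ℂ) * c⁻¹) • q V, (0 : L2 P.outer),
        -(θ V + (P.m : ℂ) • du₁ V), (0 : L2 P.outer)) :=
      d4.prodMk (continuous_const.prodMk (d3.prodMk continuous_const))
    isClosed_singleton.preimage ((continuous_weakDefect h1 h2).comp k)
  have e : (P.variationSpace c : Set P.EnergySpace) = ⋂ (φ : ℝ → ℝ) (_ : ContDiff ℝ ∞ φ)
      (_ : HasCompactSupport φ), {V : P.EnergySpace |
        P.weakDefect φ (u₂ V) (v₂ V) (du₁ V) (dv₁ V) = 0} ∩ {V : P.EnergySpace |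
        P.weakDefect φ (((P.k : ℂ) * c⁻¹) • q V) 0 (-(θ V + (P.m : ℂ) • du₁ V)) 0 = 0} := by
    ext V
    simp only [mem_iInter]
    rfl
  rw [e]
  exact isClosed_iInter fun φ => isClosed_iInter fun h1 => isClosed_iInter fun h2 =>
    (k1 φ h1 h2).inter (k2 φ h1 h2)

section VariationSpace

variable {c : ℂ} {V : P.EnergySpace}

lemma displacement_eq_of_mem_variationSpace (hV : V ∈ P.variationSpace c) :
    u₁ V = u₂ V ∧ v₁ V = v₂ V := by
  have h1 : ∀ φ, ContDiff ℝ ∞ φ → HasCompactSupport φ →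
      P.weakDefect φ (u₂ V) (v₂ V) (du₁ V) (dv₁ V) = 0 := fun φ h h' => (hV φ h h').1
  obtain ⟨hu, hv⟩ := hasWeakDeriv_of_weakDefect fun φ hφ => h1 φ hφ.smooth hφ.compact
  obtain ⟨W, e1, e2, -, -, -, -, e3, e4⟩ :=
    exists_of_isDisplacement (isDisplacement_of_weakDefect h1) hu hv 0 0 0 0
  obtain ⟨d1, d2⟩ := displacement_eq_zero (U := V - W) (by rw [map_sub, e3, sub_self])
    (by rw [map_sub, e4, sub_self])
  rw [map_sub, sub_eq_zero] at d1 d2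
  exact ⟨d1.trans e1, d2.trans e2⟩

lemma hasWeakDeriv_of_mem_variationSpace (hV : V ∈ P.variationSpace c) :
    HasWeakDeriv P.mid (((P.k : ℂ) * c⁻¹) • q V) (-(θ V + (P.m : ℂ) • du₁ V)) :=
  (hasWeakDeriv_of_weakDefect fun φ hφ => (hV φ hφ.smooth hφ.compact).2).1

lemma hasTrace_of_mem_variationSpace (hV : V ∈ P.variationSpace c) :
    HasTrace (c⁻¹ • q V) P.L₁ 0 ∧ HasTrace (c⁻¹ • q V) P.L₂ 0 := by
  have hk : (P.k : ℂ) ≠ 0 := Complex.ofReal_ne_zero.2 P.k_pos.ne'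
  have h1 := isDisplacement_of_weakDefect fun φ h h' => (hV φ h h').2
  have key : ∀ {x : ℝ} {z : ℂ}, z = 0 → HasTrace (((P.k : ℂ) * c⁻¹) • q V) x z →
      HasTrace (c⁻¹ • q V) x 0 := by
    rintro x z rfl h
    have h2 := h.smul (P.k : ℂ)⁻¹
    rwa [mul_zero, smul_smul, inv_mul_cancel_left₀ hk] at h2
  obtain ⟨z₁, h₁, h₁'⟩ := h1.interface₁
  obtain ⟨z₂, h₂, h₂'⟩ := h1.interface₂
  exact ⟨key (hasTrace_zero_eq_zero (.inl (right_mem_Icc.2 P.L₁_pos.le)) h₁') h₁,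
    key (hasTrace_zero_eq_zero (.inr (left_mem_Icc.2 P.L₂_lt_L₃.le)) h₂') h₂⟩

end VariationSpace

/-- The variation of the displacement and the velocity along a test function on the whole bar. -/
lemma exists_variation_displacement (c : ℂ) {φ : ℝ → ℝ} (hφ : IsTest P.whole φ) :
    ∃ W ∈ P.variationSpace c, ∀ V : P.EnergySpace, inner ℂ W V
      = P.weakDefect φ ((P.a : ℂ) • du₁ V - (P.m : ℂ) • θ V) ((P.b : ℂ) • dv₁ V) (u₂ V) (v₂ V) := by
  obtain ⟨f, f', hf, tf, If, If'⟩ := exists_smooth_vector mid_subset_whole hφ.smooth hφ.compact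
  obtain ⟨g, g', hg, tg, Ig, Ig'⟩ := exists_smooth_vector outer_subset_whole hφ.smooth hφ.compact
  have hfg : P.IsDisplacement f g := by
    refine ⟨⟨_, hf⟩, ⟨_, hg⟩, ?_, ?_, ⟨_, tf _, tg _⟩, ⟨_, tf _, tg _⟩⟩
    · have := tg 0
      rwa [hφ.eq_zero fun hx => hx.1.false] at this
    · have := tg P.L₃
      rwa [hφ.eq_zero fun hx => hx.2.false] at this
  obtain ⟨W, -, -, e3, e4, e5, e6, e7, e8⟩ :=
    exists_of_isDisplacement hfg hf hg (-((P.m : ℂ) • f')) 0 f g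
  refine ⟨W, fun ψ h1 h2 => ⟨?_, ?_⟩, fun V => ?_⟩
  · rw [e5, e6, e7, e8]
    exact hfg.weakDefect_eq_zero hf hg h1 h2
  · rw [e3, e4, e7]
    simp [weakDefect_zero]
  · rw [EnergySpace.inner_def, energyInner, weakDefect, e3, e4, e5, e6, e7, e8, ← If, ← If', ← Ig,
      ← Ig']
    simp only [inner_sub_right, inner_smul_right, inner_neg_left, inner_smul_left,
      Complex.conj_ofReal, inner_zero_left]
    ring

/-- The variation of the heat flux along a test function on the middle part of the bar. -/
lemma exists_variation_flux {c : ℂ} (hc : c ≠ 0) {φ : ℝ → ℝ} (hφ : IsTest P.mid φ) :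
    ∃ W ∈ P.variationSpace c, ∀ V : P.EnergySpace, inner ℂ W V
      = -P.k * (∫ x in (P.mid : Set ℝ), deriv φ x • θ V x)
        + P.τ * (conj c * ∫ x in (P.mid : Set ℝ), φ x • q V x) := by
  obtain ⟨f, f', hf, tf, If, If'⟩ := exists_smooth_vector mid_subset_whole hφ.smooth hφ.compact
  have hf0 : P.IsDisplacement f 0 := by
    have t1 := tf P.L₁
    have t2 := tf P.L₂
    rw [hφ.eq_zero fun hx => hx.1.false] at t1
    rw [hφ.eq_zero fun hx => hx.2.false] at t2
    exact ⟨⟨_, hf⟩, ⟨_, .zero _⟩, .zero _ _, .zero _ _, ⟨_, t1, by simpa using .zero _ _⟩,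
      ⟨_, t2, by simpa using .zero _ _⟩⟩
  obtain ⟨W, -, -, e3, e4, e5, e6, e7, e8⟩ := exists_of_isDisplacement
    (P.stateSubmodule.zero_mem : P.IsDisplacement 0 0) (.zero _) (.zero _)
    (-((P.k : ℂ) • f')) (c • f) 0 0
  refine ⟨W, fun ψ h1 h2 => ⟨?_, ?_⟩, fun V => ?_⟩
  · rw [e5, e6, e7, e8, weakDefect_zero]
  · rw [e3, e4, e7, smul_smul, inv_mul_cancel_right₀ hc, smul_zero, add_zero, neg_neg]
    have := P.weakDefect_smul ψ P.k f 0 f' 0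
    rw [smul_zero] at this
    rw [this, hf0.weakDefect_eq_zero hf (.zero _) h1 h2, mul_zero]
  · rw [EnergySpace.inner_def, energyInner, e3, e4, e5, e6, e7, e8, ← If, ← If']
    simp only [inner_neg_left, inner_smul_left, Complex.conj_ofReal, inner_zero_left]
    ring

/-- `1 - 𝒜` is onto. For `U` with `U - 𝒜 U = F`, the first three equations express `u¹`, `v¹` and
`θ` through `F`, `u²`, `v²` and `q`, and the other three are the Euler–Lagrange equations of the
orthogonal projection of a suitable vector `G` onto `variationSpace`. -/
lemma exists_sub_operator_eq (F : P.EnergySpace) : ∃ U, (U, U - F) ∈ P.operator.graph := by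
  have := P.completeSpace_energySpace
  have hk : (P.k : ℂ) ≠ 0 := Complex.ofReal_ne_zero.2 P.k_pos.ne'
  have hτ : (P.τ : ℂ) ≠ 0 := Complex.ofReal_ne_zero.2 P.τ_pos.ne'
  have ha : (P.a : ℂ) ≠ 0 := Complex.ofReal_ne_zero.2 P.a_pos.ne'
  have hb : (P.b : ℂ) ≠ 0 := Complex.ofReal_ne_zero.2 P.b_pos.ne'
  -- The weight of `q` in the quadratic form of the problem is `τ + 1` rather than `τ`.
  obtain ⟨c, hc, hcc, hcτ⟩ : ∃ c : ℂ, c ≠ 0 ∧ conj c = c ∧ P.τ * c ^ 2 = P.τ + 1 := by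
    have h1 : 0 < (P.τ + 1) / P.τ := div_pos (by linarith [P.τ_pos]) P.τ_pos
    refine ⟨(√((P.τ + 1) / P.τ) : ℝ), Complex.ofReal_ne_zero.2 (Real.sqrt_pos.2 h1).ne',
      Complex.conj_ofReal _, ?_⟩
    rw [← Complex.ofReal_pow, Real.sq_sqrt h1.le]
    push_cast
    field_simp
  let M := P.variationSpace c
  have : CompleteSpace M := (P.isClosed_variationSpace c).completeSpace_coe
  obtain ⟨G, -, -, g3, g4, g5, g6, g7, g8⟩ := exists_of_isDisplacement (-F).isDisplacement
    (hasWeakDeriv_u₁ (-F)) (hasWeakDeriv_v₁ (-F)) (-θ F) (c⁻¹ • q F) (u₂ F) (v₂ F)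
  obtain ⟨V, hV, Z, hZ, rfl⟩ := M.exists_add_mem_mem_orthogonal G
  obtain ⟨U, u1, u2, u3, u4, u5, u6, u7, u8⟩ := exists_of_isDisplacement (F + V).isDisplacement
    (hasWeakDeriv_u₁ (F + V)) (hasWeakDeriv_v₁ (F + V)) (θ F + θ V) (c⁻¹ • q V) (u₂ V) (v₂ V)
  change u₁ U = u₁ (F + V) at u1
  change v₁ U = v₁ (F + V) at u2
  simp only [map_add, map_neg] at g3 g4 g5 g6 g7 g8 u1 u2 u7 u8
  obtain ⟨w1, w2⟩ := displacement_eq_of_mem_variationSpace hV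
  have wq := hasWeakDeriv_of_mem_variationSpace hV
  obtain ⟨wt1, wt2⟩ := hasTrace_of_mem_variationSpace hV
  -- The components of `Z = G - V`, up to the sign those of `U` or of `𝒜 U = U - F`.
  have z3 : θ Z = -θ U := by rw [u3, eq_sub_of_add_eq' g3]; abel
  have z5 : u₂ Z = -u₂ (U - F) := by rw [map_sub, u5, eq_sub_of_add_eq' g5]; abel
  have z6 : v₂ Z = -v₂ (U - F) := by rw [map_sub, u6, eq_sub_of_add_eq' g6]; abel
  have z7 : du₁ Z = -du₁ U := by rw [u7, eq_sub_of_add_eq' g7]; abel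
  have z8 : dv₁ Z = -dv₁ U := by rw [u8, eq_sub_of_add_eq' g8]; abel
  have z4 : q Z = c⁻¹ • q F - c • q U := by
    rw [u4, smul_inv_smul₀ hc, eq_sub_of_add_eq' g4]
  have stress : ∀ φ, IsTest P.whole φ → P.weakDefect φ ((P.a : ℂ) • du₁ U - (P.m : ℂ) • θ U)
      ((P.b : ℂ) • dv₁ U) (u₂ (U - F)) (v₂ (U - F)) = 0 := by
    intro φ hφ
    obtain ⟨W, hW, hWi⟩ := exists_variation_displacement c hφ
    have h1 := hZ W hW
    rw [hWi, z3, z5, z6, z7, z8] at h1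
    have h2 := P.weakDefect_smul φ (-1) ((P.a : ℂ) • du₁ U - (P.m : ℂ) • θ U)
      ((P.b : ℂ) • dv₁ U) (u₂ (U - F)) (v₂ (U - F))
    have h3 : (P.a : ℂ) • -du₁ U - (P.m : ℂ) • -θ U
        = (-1 : ℂ) • ((P.a : ℂ) • du₁ U - (P.m : ℂ) • θ U) := by module
    have h4 : (P.b : ℂ) • -dv₁ U = (-1 : ℂ) • (P.b : ℂ) • dv₁ U := by module
    rw [h3, h4, ← neg_one_smul ℂ (u₂ (U - F)), ← neg_one_smul ℂ (v₂ (U - F)), h2] at h1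
    linear_combination -h1
  have row₄ : HasWeakDeriv P.mid (-((P.k / P.τ : ℂ) • θ U)) (q (U - F) + (1 / P.τ : ℂ) • q U) := by
    intro φ hφ
    obtain ⟨W, hW, hWi⟩ := exists_variation_flux hc hφ
    have h1 := hZ W hW
    rw [hWi, z3, z4, hcc, ← neg_one_smul ℂ (θ U), integral_smul_smul,
      sub_eq_add_neg, ← neg_smul, Cattaneo.integral_smul_add hφ.smooth.continuous hφ.compact,
      integral_smul_smul, integral_smul_smul] at h1
    rw [map_sub, sub_eq_add_neg, ← neg_one_smul ℂ (q F), ← neg_smul, integral_smul_smul,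
      Cattaneo.integral_smul_add hφ.smooth.continuous hφ.compact,
      Cattaneo.integral_smul_add hφ.smooth.continuous hφ.compact, integral_smul_smul,
      integral_smul_smul]
    simp only [smul_eq_mul] at h1 ⊢
    field_simp at h1 ⊢
    linear_combination -h1 - (∫ x in (P.mid : Set ℝ), φ x • q U x) * hcτ
  obtain ⟨row₅, row₆⟩ := hasWeakDeriv_of_weakDefect stress
  obtain ⟨⟨y₁, hy₁, hy₁'⟩, y₂, hy₂, hy₂'⟩ := hasTrace_of_weakDefect stress
  have himage : P.IsImage U (U - F) := by
    refine ⟨?_, ?_, ?_, row₄, row₅, row₆⟩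
    · rw [map_sub, u1, u5, ← w1, add_sub_cancel_left]
    · rw [map_sub, u2, u6, ← w2, add_sub_cancel_left]
    · have h1 := (wq.smul (-1)).add ((hasWeakDeriv_u₁ V).smul (-(P.m : ℂ)))
      rw [map_sub, u3, u4, u5, ← w1]
      convert h1 using 1 <;> module
  have hforce : ∀ {x : ℝ} {y : ℂ}, HasTrace ((P.a : ℂ) • du₁ U - (P.m : ℂ) • θ U) x y →
      HasTrace ((P.b : ℂ) • dv₁ U) x y → P.ForceMatching U x := by
    intro x y h1 h2
    obtain ⟨t, ht⟩ := exists_hasTrace_mid himage.hasWeakDeriv_θ x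
    refine ⟨(P.a : ℂ)⁻¹ * (y + P.m * t), t, (P.b : ℂ)⁻¹ * y, ?_, ht, ?_, ?_⟩
    · have := (h1.add (ht.smul (P.m : ℂ))).smul (P.a : ℂ)⁻¹
      rwa [sub_add_cancel, inv_smul_smul₀ ha] at this
    · have := h2.smul (P.b : ℂ)⁻¹
      rwa [inv_smul_smul₀ hb] at this
    · field_simp
      ring
  refine ⟨U, P.mem_graph_operator.2 ⟨himage, hforce hy₁ hy₁', hforce hy₂ hy₂', ?_, ?_⟩⟩
  · rwa [u4]
  · rwa [u4]

end Bar
end Cattaneo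
end

theorem mainTheorem4 (P : Cattaneo.Bar) :
    CompleteSpace P.EnergySpace ∧
    Dense (P.operator.domain : Set P.EnergySpace) ∧
    P.operator.IsClosed ∧
    ∃ T : ℝ≥0 → P.EnergySpace →L[ℂ] P.EnergySpace,
      Cattaneo.IsContractionSemigroup T ∧ Cattaneo.IsGenerator P.operator T := by
  have := P.completeSpace_energySpace
  have hdiss := P.isDissipative_operator
  have hsurj : ∀ F, ∃ U, (U, U - F) ∈ P.operator.graph := Cattaneo.Bar.exists_sub_operator_eq
  exact ⟨this, hdiss.dense_domain hsurj, hdiss.isClosed hsurj, hdiss.exists_isGenerator hsurj⟩
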